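/- Let $(M,g)$ be a closed (compact, without boundary) Kähler manifold of complex dimension $2$. In local holomorphic coordinates $(z^1,z^2)$ write $g_{i\bar j}=g(\partial_{z^i},\partial_{\bar z^j})$ and $u_{i\bar j}=\partial^2u/\partial z^i\partial\bar z^j$, and let $\Delta u=g^{i\bar j}u_{i\bar j}$ be the complex Laplacian. Then for all $A, B, S\in\mathbb{R}$ and $L\ge 0$ there is a constant $C$, depending only on $(M,g)$, $A$, $B$, $S$ and $L$, such that the following holds. Let $f:M\to\mathbb{R}$ be a positive function and let $\phi\in C^4(M)$ be a real-valued solution of the Monge--Ampère equation $$\det(g_{i\bar j}+\phi_{i\bar j})=f\,\det(g_{i\bar j})$$ on $M$ such that $(g_{i\bar j}+\phi_{i\bar j})$ is positive definite (in particular $f$ is of class $C^2$). If $\inf_M\Delta f\ge -A$, $f^{1/2}$ is Lipschitz with constant $L$ for the Riemannian distance of $g$, $\sup_M f\le S$, and $\sup_M\phi-\inf_M\phi\le B$, then $$|\Delta\phi|\le C\quad\text{on } M.$$ -/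

import Mathlib

open scoped Manifold ContDiff Bundle ComplexOrder NNReal ENNReal

noncomputable section

namespace KahlerSurface

/-- The model space `ℂ²`. -/
abbrev C2 : Type := EuclideanSpace ℂ (Fin 2)

/-- The coordinate vector `∂/∂xⁱ` of `ℂ² = ℝ⁴`, where `zⁱ = xⁱ + √-1 yⁱ`. -/
def dx (i : Fin 2) : C2 := EuclideanSpace.single i 1

/-- The coordinate vector `∂/∂yⁱ` of `ℂ² = ℝ⁴`, where `zⁱ = xⁱ + √-1 yⁱ`. -/
def dy (i : Fin 2) : C2 := EuclideanSpace.single i Complex.I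

/-- The Wirtinger derivative `∂F/∂zⁱ = (1/2) (∂F/∂xⁱ - √-1 ∂F/∂yⁱ)`. -/
def wirtinger (i : Fin 2) (F : C2 → ℂ) (z : C2) : ℂ :=
  (1 / 2) * (fderiv ℝ F z (dx i) - Complex.I * fderiv ℝ F z (dy i))

/-- The Wirtinger derivative `∂F/∂z̄ⁱ = (1/2) (∂F/∂xⁱ + √-1 ∂F/∂yⁱ)`. -/
def wirtingerBar (i : Fin 2) (F : C2 → ℂ) (z : C2) : ℂ :=
  (1 / 2) * (fderiv ℝ F z (dx i) + Complex.I * fderiv ℝ F z (dy i))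

/-- The matrix `(u_{i j̄}) = (∂²u / ∂zⁱ ∂z̄ʲ)` of a real function `u` on `ℂ²`. -/
def complexHessian (u : C2 → ℝ) (z : C2) : Matrix (Fin 2) (Fin 2) ℂ :=
  Matrix.of fun i j => wirtinger i (wirtingerBar j fun w => (u w : ℂ)) z

section Manifold

variable (M : Type*) [TopologicalSpace M] [ChartedSpace C2 M]

/-- A complex surface is in particular a smooth real four-manifold. -/
instance isManifold_real [IsManifold 𝓘(ℂ, C2) ω M] : IsManifold 𝓘(ℝ, C2) ∞ M := by
  refine isManifold_of_contDiffOn 𝓘(ℝ, C2) ∞ M fun e e' he he' => ?_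
  have h := (contDiffGroupoid ω 𝓘(ℂ, C2)).compatible he he'
  rw [contDiffGroupoid, mem_groupoid_of_pregroupoid] at h
  have h1 : ContDiffOn ℂ ω _ _ := h.1
  exact (h1.of_le le_top).restrict_scalars ℝ

variable {M}

/-- The complex structure `J` on the tangent spaces. The tangent space at `p` is identified with
`ℂ²` through the holomorphic chart `chartAt C2 p`. -/
def tangentJ (p : M) (v : TangentSpace 𝓘(ℝ, C2) p) : TangentSpace 𝓘(ℝ, C2) p :=
  (Complex.I • (show C2 from v) : C2)

/-- The real tangent vector on `M` that has the constant coordinates `v` in the chart `e`, at the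
point with coordinates `z`. -/
def coordVector (e : OpenPartialHomeomorph M C2) (z : C2) (v : C2) :
    TangentSpace 𝓘(ℝ, C2) (e.symm z) :=
  mfderiv 𝓘(ℝ, C2) 𝓘(ℝ, C2) e.symm z v

/-- Given a field `G` of real bilinear forms on the tangent spaces, the matrix
`G_{i j̄} = G(∂/∂zⁱ, ∂/∂z̄ʲ)` of its complex bilinear extension in the coordinates `e`, at the
point with coordinates `z`; here `∂/∂zⁱ = (1/2) (∂/∂xⁱ - √-1 ∂/∂yⁱ)` and
`∂/∂z̄ʲ = (1/2) (∂/∂xʲ + √-1 ∂/∂yʲ)`. -/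
def coordMatrix
    (G : ∀ p : M, TangentSpace 𝓘(ℝ, C2) p →L[ℝ] TangentSpace 𝓘(ℝ, C2) p →L[ℝ] ℝ)
    (e : OpenPartialHomeomorph M C2) (z : C2) : Matrix (Fin 2) (Fin 2) ℂ :=
  Matrix.of fun i j =>
    (1 / 4) *
      (((G (e.symm z) (coordVector e z (dx i)) (coordVector e z (dx j)) : ℝ) : ℂ)
        + ((G (e.symm z) (coordVector e z (dy i)) (coordVector e z (dy j)) : ℝ) : ℂ)
        + Complex.I *
          (((G (e.symm z) (coordVector e z (dx i)) (coordVector e z (dy j)) : ℝ) : ℂ)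
            - ((G (e.symm z) (coordVector e z (dy i)) (coordVector e z (dx j)) : ℝ) : ℂ)))

end Manifold

/-- A Kähler metric on a complex surface: a smooth Riemannian metric `g` that is `J`-invariant and
whose fundamental form is closed, i.e. `∂_k g_{i j̄} = ∂_i g_{k j̄}` in all holomorphic
coordinates. -/
structure KahlerMetric (M : Type*) [TopologicalSpace M] [ChartedSpace C2 M]
    [IsManifold 𝓘(ℂ, C2) ω M] extends
    Bundle.ContMDiffRiemannianMetric 𝓘(ℝ, C2) ∞ C2
      (fun p : M => TangentSpace 𝓘(ℝ, C2) p) where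
  hermitian : ∀ (p : M) (v w : TangentSpace 𝓘(ℝ, C2) p),
    inner p (tangentJ p v) (tangentJ p w) = inner p v w
  closed : ∀ e ∈ IsManifold.maximalAtlas 𝓘(ℂ, C2) ω M, ∀ z ∈ e.target, ∀ i j k : Fin 2,
    wirtinger k (fun w => coordMatrix inner e w i j) z
      = wirtinger i (fun w => coordMatrix inner e w k j) z

namespace KahlerMetric

variable {M : Type*} [TopologicalSpace M] [ChartedSpace C2 M] [IsManifold 𝓘(ℂ, C2) ω M]

/-- The matrix `(g_{i j̄})` at `p` in the coordinates `e`. -/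
def matrix (g : KahlerMetric M) (e : OpenPartialHomeomorph M C2) (p : M) :
    Matrix (Fin 2) (Fin 2) ℂ :=
  coordMatrix g.inner e (e p)

/-- The Riemannian distance of `g`: the infimum of the `g`-lengths of `C¹` paths. -/
def rdist (g : KahlerMetric M) (p q : M) : ℝ≥0∞ :=
  letI : Bundle.RiemannianBundle (fun p : M => TangentSpace 𝓘(ℝ, C2) p) :=
    ⟨g.toContMDiffRiemannianMetric.toRiemannianMetric⟩
  Manifold.riemannianEDist 𝓘(ℝ, C2) p q

/-- `h` is Lipschitz with constant `L` for the Riemannian distance of `g`. -/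
def IsLipschitz (g : KahlerMetric M) (L : ℝ≥0) (h : M → ℝ) : Prop :=
  ∀ p q : M, edist (h p) (h q) ≤ L * g.rdist p q

end KahlerMetric

section Functions

variable {M : Type*} [TopologicalSpace M] [ChartedSpace C2 M]

/-- The matrix `(u_{i j̄})` of a function `u` on `M` at `p` in the coordinates `e`. -/
def hessianMatrix (u : M → ℝ) (e : OpenPartialHomeomorph M C2) (p : M) :
    Matrix (Fin 2) (Fin 2) ℂ :=
  complexHessian (u ∘ e.symm) (e p)

variable [IsManifold 𝓘(ℂ, C2) ω M]

/-- The complex Laplacian `Δu = g^{i j̄} u_{i j̄}`. For a `C²` function `u` the trace is real and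
does not depend on the holomorphic coordinates; it is evaluated at `p` in the chart at `p`. -/
def KahlerMetric.laplacian (g : KahlerMetric M) (u : M → ℝ) (p : M) : ℝ :=
  (Matrix.trace ((g.matrix (chartAt C2 p) p)⁻¹ * hessianMatrix u (chartAt C2 p) p)).re

/-- `φ` solves `det (g_{i j̄} + φ_{i j̄}) = f det (g_{i j̄})` in all holomorphic coordinates. -/
def KahlerMetric.SolvesMongeAmpere (g : KahlerMetric M) (f φ : M → ℝ) : Prop :=
  ∀ e ∈ IsManifold.maximalAtlas 𝓘(ℂ, C2) ω M, ∀ p ∈ e.source,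
    (g.matrix e p + hessianMatrix φ e p).det = (f p : ℂ) * (g.matrix e p).det

/-- `(g_{i j̄} + φ_{i j̄})` is positive definite in all holomorphic coordinates. -/
def KahlerMetric.IsAdmissible (g : KahlerMetric M) (φ : M → ℝ) : Prop :=
  ∀ e ∈ IsManifold.maximalAtlas 𝓘(ℂ, C2) ω M, ∀ p ∈ e.source,
    (g.matrix e p + hessianMatrix φ e p).PosDef

end Functions

end KahlerSurface

end

open KahlerSurface

/-! The proof applies the maximum principle to `T * exp (-lam * φ)`, where `T = 2 + Δφ` is the trace
of `g' = g + ∂∂̄φ` with respect to `g`. Positivity of `g'` gives `T > 0`, hence `Δφ > -2`; only the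
upper bound needs work.

At a maximum `p`, choose holomorphic coordinates with `g = 1` and `g' = diag(a, b)`, so that `T = a
+ b` and `f = ab`. A linear change of a fixed chart suffices, since first derivatives of `g` need
not vanish. The linearised operator is applied in the cofactor form `b ∂₁∂̄₁ + a ∂₂∂̄₂`, that is,
`f` times the Laplacian of `g'`, so no lower bound on `f` is needed. Differentiating `f det g = det
g'` and the polynomial formula for `T det g` twice gives `trace_sub_laplacian_identity`: `b T₁₁̄ + a
T₂₂̄ - Δf` equals `(a - b)²` times a bisectional curvature of `g`, plus a quadratic form in the
covariant derivatives of `g'`.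

The quadratic form is indefinite. By `normSq_add_div_le` it is at least `(b|T₁|² + a|T₂|²)/T -
|∂f|²/f`. The first term absorbs the gradient terms in the second-order condition at the maximum
(`hessian_le_of_isLocalMax`). The second is bounded because `f^{1/2}` is Lipschitz: `|∂f|² ≤ 8L²f`
in unitary coordinates (`sum_normSq_wirtinger_le`).

Let `C ≥ 0` be an upper bound for `∂₂∂̄₂g₁₁̄` in such coordinates; compactness makes it uniform
(`KahlerMetric.exists_frameSecondDeriv_bound`). Since `b(a - 1) + a(b - 1) = 2f - T`, the
exponential contributes `lam T (2f - T)`, whence `(lam - C) T² ≤ A + 8L² + 2 lam f T` at `p`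
(`quadratic_estimate_of_isLocalMax`). Taking `lam = C + 1` bounds `T` at `p`, and the oscillation
bound on `φ` carries this to all of `M`. -/

noncomputable section

namespace KahlerSurface

open Filter Topology ComplexConjugate

/-! ### Wirtinger calculus on `ℂ²` -/

section WirtingerCalculus

variable {F G : C2 → ℂ} {z : C2} {i j : Fin 2}

lemma dy_eq (i : Fin 2) : dy i = Complex.I • dx i := by
  ext r
  by_cases h : r = i <;> simp [dx, dy, h]

lemma sum_smul_dx (v : C2) : ∑ r, v r • dx r = v := by
  ext r
  fin_cases r <;> simp [dx, Fin.sum_univ_two]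

lemma _root_.Filter.EventuallyEq.wirtinger_eq (h : F =ᶠ[𝓝 z] G) :
    wirtinger i F z = wirtinger i G z := by
  simp only [wirtinger, h.fderiv_eq]

lemma _root_.Filter.EventuallyEq.wirtingerBar_eq (h : F =ᶠ[𝓝 z] G) :
    wirtingerBar i F z = wirtingerBar i G z := by
  simp only [wirtingerBar, h.fderiv_eq]

lemma _root_.Filter.EventuallyEq.wirtinger (h : F =ᶠ[𝓝 z] G) :
    wirtinger i F =ᶠ[𝓝 z] wirtinger i G :=
  h.eventuallyEq_nhds.mono fun _ hw => hw.wirtinger_eq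

lemma _root_.Filter.EventuallyEq.wirtingerBar (h : F =ᶠ[𝓝 z] G) :
    wirtingerBar i F =ᶠ[𝓝 z] wirtingerBar i G :=
  h.eventuallyEq_nhds.mono fun _ hw => hw.wirtingerBar_eq

lemma wirtinger_add (hF : DifferentiableAt ℝ F z) (hG : DifferentiableAt ℝ G z) :
    wirtinger i (fun w => F w + G w) z = wirtinger i F z + wirtinger i G z := by
  simp only [wirtinger, fderiv_fun_add hF hG, _root_.add_apply]
  ring

lemma wirtingerBar_add (hF : DifferentiableAt ℝ F z) (hG : DifferentiableAt ℝ G z) :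
    wirtingerBar i (fun w => F w + G w) z = wirtingerBar i F z + wirtingerBar i G z := by
  simp only [wirtingerBar, fderiv_fun_add hF hG, _root_.add_apply]
  ring

lemma wirtinger_sub (hF : DifferentiableAt ℝ F z) (hG : DifferentiableAt ℝ G z) :
    wirtinger i (fun w => F w - G w) z = wirtinger i F z - wirtinger i G z := by
  simp only [wirtinger, fderiv_fun_sub hF hG, _root_.sub_apply]
  ring

lemma wirtingerBar_sub (hF : DifferentiableAt ℝ F z) (hG : DifferentiableAt ℝ G z) :
    wirtingerBar i (fun w => F w - G w) z = wirtingerBar i F z - wirtingerBar i G z := by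
  simp only [wirtingerBar, fderiv_fun_sub hF hG, _root_.sub_apply]
  ring

lemma wirtinger_mul (hF : DifferentiableAt ℝ F z) (hG : DifferentiableAt ℝ G z) :
    wirtinger i (fun w => F w * G w) z = wirtinger i F z * G z + F z * wirtinger i G z := by
  simp only [wirtinger, fderiv_fun_mul hF hG, _root_.add_apply,
    _root_.smul_apply, smul_eq_mul]
  ring

lemma wirtingerBar_mul (hF : DifferentiableAt ℝ F z) (hG : DifferentiableAt ℝ G z) :
    wirtingerBar i (fun w => F w * G w) z
      = wirtingerBar i F z * G z + F z * wirtingerBar i G z := by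
  simp only [wirtingerBar, fderiv_fun_mul hF hG, _root_.add_apply,
    _root_.smul_apply, smul_eq_mul]
  ring

lemma wirtinger_const (c : ℂ) : wirtinger i (fun _ => c) z = 0 := by
  simp [wirtinger]

lemma wirtingerBar_const (c : ℂ) : wirtingerBar i (fun _ => c) z = 0 := by
  simp [wirtingerBar]

lemma wirtinger_sum {ι : Type*} (s : Finset ι) {F : ι → C2 → ℂ}
    (hF : ∀ k ∈ s, DifferentiableAt ℝ (F k) z) :
    wirtinger i (fun w => ∑ k ∈ s, F k w) z = ∑ k ∈ s, wirtinger i (F k) z := by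
  simp only [wirtinger, fderiv_fun_sum hF, _root_.sum_apply, Finset.mul_sum,
    ← Finset.sum_sub_distrib]

lemma wirtingerBar_sum {ι : Type*} (s : Finset ι) {F : ι → C2 → ℂ}
    (hF : ∀ k ∈ s, DifferentiableAt ℝ (F k) z) :
    wirtingerBar i (fun w => ∑ k ∈ s, F k w) z = ∑ k ∈ s, wirtingerBar i (F k) z := by
  simp only [wirtingerBar, fderiv_fun_sum hF, _root_.sum_apply, Finset.mul_sum,
    ← Finset.sum_add_distrib]

lemma fderiv_conj_apply (v : C2) :
    fderiv ℝ (fun w => conj (F w)) z v = conj (fderiv ℝ F z v) := by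
  have h := Complex.conjCLE.comp_fderiv (f := F) (x := z)
  have h2 : (fun w => conj (F w)) = Complex.conjCLE ∘ F := rfl
  rw [h2, h]
  rfl

lemma wirtinger_conj : wirtinger i (fun w => conj (F w)) z = conj (wirtingerBar i F z) := by
  simp only [wirtinger, wirtingerBar, fderiv_conj_apply, map_mul, map_add, Complex.conj_I,
    map_div₀, map_one, map_ofNat]
  ring

lemma wirtingerBar_conj : wirtingerBar i (fun w => conj (F w)) z = conj (wirtinger i F z) := by
  simp only [wirtinger, wirtingerBar, fderiv_conj_apply, map_mul, map_sub, Complex.conj_I,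
    map_div₀, map_one, map_ofNat]
  ring

lemma contDiffAt_fderiv_apply {m n : ℕ∞ω} (hF : ContDiffAt ℝ n F z) (hmn : m + 1 ≤ n) (v : C2) :
    ContDiffAt ℝ m (fun w => fderiv ℝ F w v) z :=
  (hF.fderiv_right hmn).clm_apply contDiffAt_const

lemma _root_.ContDiffAt.wirtinger {m n : ℕ∞ω} (hF : ContDiffAt ℝ n F z) (hmn : m + 1 ≤ n) :
    ContDiffAt ℝ m (wirtinger i F) z :=
  contDiffAt_const.mul ((contDiffAt_fderiv_apply hF hmn _).sub
    (contDiffAt_const.mul (contDiffAt_fderiv_apply hF hmn _)))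

lemma _root_.ContDiffAt.wirtingerBar {m n : ℕ∞ω} (hF : ContDiffAt ℝ n F z) (hmn : m + 1 ≤ n) :
    ContDiffAt ℝ m (wirtingerBar i F) z :=
  contDiffAt_const.mul ((contDiffAt_fderiv_apply hF hmn _).add
    (contDiffAt_const.mul (contDiffAt_fderiv_apply hF hmn _)))

lemma differentiableAt_fderiv_apply (hF : ContDiffAt ℝ 2 F z) (v : C2) :
    DifferentiableAt ℝ (fun w => fderiv ℝ F w v) z :=
  (contDiffAt_fderiv_apply (m := 1) hF (by norm_num) v).differentiableAt (by norm_num)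

lemma fderiv_fderiv_apply (hF : ContDiffAt ℝ 2 F z) (v w : C2) :
    fderiv ℝ (fun x => fderiv ℝ F x v) z w = fderiv ℝ (fderiv ℝ F) z w v := by
  have h : DifferentiableAt ℝ (fderiv ℝ F) z :=
    (hF.fderiv_right (m := 1) (by norm_num)).differentiableAt (by norm_num)
  rw [fderiv_clm_apply h (differentiableAt_const v)]
  simp

lemma fderiv_fderiv_comm (hF : ContDiffAt ℝ 2 F z) (v w : C2) :
    fderiv ℝ (fun x => fderiv ℝ F x v) z w = fderiv ℝ (fun x => fderiv ℝ F x w) z v := by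
  rw [fderiv_fderiv_apply hF, fderiv_fderiv_apply hF]
  exact (hF.isSymmSndFDerivAt (by simp)) w v

lemma fderiv_wirtinger (hF : ContDiffAt ℝ 2 F z) (v : C2) :
    fderiv ℝ (wirtinger i F) z v = (1 / 2) * (fderiv ℝ (fun x => fderiv ℝ F x (dx i)) z v
      - Complex.I * fderiv ℝ (fun x => fderiv ℝ F x (dy i)) z v) := by
  have h1 := differentiableAt_fderiv_apply hF (dx i)
  have h2 := differentiableAt_fderiv_apply hF (dy i)
  have : wirtinger i F = fun z => (1 / 2) * (fderiv ℝ F z (dx i)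
      - Complex.I * fderiv ℝ F z (dy i)) := rfl
  rw [this, fderiv_const_mul (h1.fun_sub (h2.const_mul _)), fderiv_fun_sub h1 (h2.const_mul _),
    fderiv_const_mul h2]
  simp

lemma fderiv_wirtingerBar (hF : ContDiffAt ℝ 2 F z) (v : C2) :
    fderiv ℝ (wirtingerBar i F) z v = (1 / 2) * (fderiv ℝ (fun x => fderiv ℝ F x (dx i)) z v
      + Complex.I * fderiv ℝ (fun x => fderiv ℝ F x (dy i)) z v) := by
  have h1 := differentiableAt_fderiv_apply hF (dx i)
  have h2 := differentiableAt_fderiv_apply hF (dy i)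
  have : wirtingerBar i F = fun z => (1 / 2) * (fderiv ℝ F z (dx i)
      + Complex.I * fderiv ℝ F z (dy i)) := rfl
  rw [this, fderiv_const_mul (h1.fun_add (h2.const_mul _)), fderiv_fun_add h1 (h2.const_mul _),
    fderiv_const_mul h2]
  simp
  ring

lemma wirtinger_comm (hF : ContDiffAt ℝ 2 F z) :
    wirtinger i (wirtinger j F) z = wirtinger j (wirtinger i F) z := by
  rw [wirtinger, wirtinger, fderiv_wirtinger hF, fderiv_wirtinger hF, fderiv_wirtinger hF,
    fderiv_wirtinger hF, fderiv_fderiv_comm hF (dx j) (dx i), fderiv_fderiv_comm hF (dx j) (dy i),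
    fderiv_fderiv_comm hF (dy j) (dx i), fderiv_fderiv_comm hF (dy j) (dy i)]
  ring

lemma wirtinger_wirtingerBar_comm (hF : ContDiffAt ℝ 2 F z) :
    wirtinger i (wirtingerBar j F) z = wirtingerBar j (wirtinger i F) z := by
  rw [wirtinger, wirtingerBar, fderiv_wirtinger hF, fderiv_wirtinger hF, fderiv_wirtingerBar hF,
    fderiv_wirtingerBar hF, fderiv_fderiv_comm hF (dx j) (dx i),
    fderiv_fderiv_comm hF (dx j) (dy i),
    fderiv_fderiv_comm hF (dy j) (dx i), fderiv_fderiv_comm hF (dy j) (dy i)]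
  ring

/-- A real linear map on `ℂ²` splits into its complex linear and antilinear parts. -/
lemma fderiv_eq_sum_wirtinger (v : C2) :
    fderiv ℝ F z v = ∑ r, (v r * wirtinger r F z + conj (v r) * wirtingerBar r F z) := by
  have h (r : Fin 2) : fderiv ℝ F z (v r • dx r)
      = v r * wirtinger r F z + conj (v r) * wirtingerBar r F z := by
    have h1 : v r • dx r = (v r).re • dx r + (v r).im • dy r := by
      rw [dy_eq]
      conv_lhs => rw [← Complex.re_add_im (v r)]
      rw [add_smul, mul_smul, Complex.coe_smul, Complex.coe_smul]
    rw [h1, map_add, map_smul, map_smul, wirtinger, wirtingerBar, Complex.real_smul,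
      Complex.real_smul]
    conv_rhs => rw [← Complex.re_add_im (v r)]
    simp only [map_add, map_mul, Complex.conj_ofReal, Complex.conj_I]
    linear_combination ((v r).im * fderiv ℝ F z (dy r)) * Complex.I_sq
  conv_lhs => rw [← sum_smul_dx v]
  rw [map_sum]
  exact Finset.sum_congr rfl fun r _ => h r

/-! ### Holomorphic changes of variable -/

section Holomorphic

variable {τ : C2 → C2}

/-- The Jacobian matrix `∂τʳ/∂zⁱ` of a holomorphic map. -/
def jacobian (τ : C2 → C2) (z : C2) : Matrix (Fin 2) (Fin 2) ℂ :=
  Matrix.of fun r i => fderiv ℂ τ z (dx i) r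

lemma fderiv_comp_holomorphic (hτ : DifferentiableAt ℂ τ z) (hF : DifferentiableAt ℝ F (τ z))
    (v : C2) : fderiv ℝ (fun w => F (τ w)) z v = fderiv ℝ F (τ z) (fderiv ℂ τ z v) := by
  have h : HasFDerivAt τ ((fderiv ℂ τ z).restrictScalars ℝ) z := hτ.hasFDerivAt.restrictScalars ℝ
  rw [show (fun w => F (τ w)) = F ∘ τ from rfl, (hF.hasFDerivAt.comp z h).fderiv]
  rfl

lemma wirtinger_comp (hτ : DifferentiableAt ℂ τ z) (hF : DifferentiableAt ℝ F (τ z)) :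
    wirtinger i (fun w => F (τ w)) z = ∑ r, jacobian τ z r i * wirtinger r F (τ z) := by
  rw [wirtinger, fderiv_comp_holomorphic hτ hF, fderiv_comp_holomorphic hτ hF, dy_eq, map_smul,
    fderiv_eq_sum_wirtinger, fderiv_eq_sum_wirtinger]
  simp only [Fin.sum_univ_two, jacobian, Matrix.of_apply, PiLp.smul_apply, smul_eq_mul, map_mul,
    Complex.conj_I]
  ring_nf
  simp only [Complex.I_sq]
  ring

lemma wirtingerBar_comp (hτ : DifferentiableAt ℂ τ z) (hF : DifferentiableAt ℝ F (τ z)) :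
    wirtingerBar i (fun w => F (τ w)) z
      = ∑ r, conj (jacobian τ z r i) * wirtingerBar r F (τ z) := by
  rw [wirtingerBar, fderiv_comp_holomorphic hτ hF, fderiv_comp_holomorphic hτ hF, dy_eq, map_smul,
    fderiv_eq_sum_wirtinger, fderiv_eq_sum_wirtinger]
  simp only [Fin.sum_univ_two, jacobian, Matrix.of_apply, PiLp.smul_apply, smul_eq_mul, map_mul,
    Complex.conj_I]
  ring_nf
  simp only [Complex.I_sq]
  ring

lemma wirtingerBar_eq_zero (hF : DifferentiableAt ℂ F z) : wirtingerBar i F z = 0 := by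
  have h : fderiv ℝ F z = (fderiv ℂ F z).restrictScalars ℝ :=
    (hF.hasFDerivAt.restrictScalars ℝ).fderiv
  rw [wirtingerBar, h, dy_eq]
  simp only [ContinuousLinearMap.coe_restrictScalars', map_smul, smul_eq_mul]
  linear_combination (1 / 2 * fderiv ℂ F z (dx i)) * Complex.I_sq

lemma differentiableAt_jacobian (hτ : ContDiffAt ℂ 2 τ z) (r i : Fin 2) :
    DifferentiableAt ℂ (fun w => jacobian τ w r i) z := by
  have h1 : DifferentiableAt ℂ (fun w => fderiv ℂ τ w (dx i)) z :=
    ((hτ.fderiv_right (m := 1) (by norm_num)).clm_apply contDiffAt_const).differentiableAt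
      (by norm_num)
  exact (differentiableAt_piLp 2).1 h1 r

/-- The mixed second derivatives transform as a sesquilinear form under holomorphic maps. -/
lemma wirtinger_wirtingerBar_comp (hτ : ContDiffAt ℂ 2 τ z) (hF : ContDiffAt ℝ 2 F (τ z)) :
    wirtinger i (wirtingerBar j fun w => F (τ w)) z
      = ∑ r, ∑ s, jacobian τ z r i * wirtinger r (wirtingerBar s F) (τ z)
          * conj (jacobian τ z s j) := by
  have hcont : ContinuousAt τ z := hτ.continuousAt
  have hev : wirtingerBar j (fun w => F (τ w)) =ᶠ[𝓝 z]
      fun w => ∑ s, conj (jacobian τ w s j) * wirtingerBar s F (τ w) := by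
    have h1 : ∀ᶠ w in 𝓝 z, ContDiffAt ℂ 2 τ w := hτ.eventually (by simp)
    have h2 : ∀ᶠ w in 𝓝 z, ContDiffAt ℝ 2 F (τ w) :=
      hcont.eventually (hF.eventually (by simp))
    filter_upwards [h1, h2] with w hw1 hw2
    exact wirtingerBar_comp (hw1.differentiableAt (by norm_num))
      (hw2.differentiableAt (by norm_num))
  have hτd : DifferentiableAt ℂ τ z := hτ.differentiableAt (by norm_num)
  have hτr : DifferentiableAt ℝ τ z := hτd.restrictScalars ℝ
  have hJ (s : Fin 2) : DifferentiableAt ℝ (fun w => conj (jacobian τ w s j)) z :=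
    Complex.conjCLE.differentiableAt.comp z
      ((differentiableAt_jacobian hτ s j).restrictScalars ℝ)
  have hB (s : Fin 2) : DifferentiableAt ℝ (wirtingerBar s F) (τ z) :=
    (hF.wirtingerBar (m := 1) (by norm_num)).differentiableAt (by norm_num)
  have hBc (s : Fin 2) : DifferentiableAt ℝ (fun w => wirtingerBar s F (τ w)) z :=
    (hB s).comp z hτr
  rw [hev.wirtinger_eq, wirtinger_sum _ fun s _ => (hJ s).fun_mul (hBc s), Finset.sum_comm]
  refine Finset.sum_congr rfl fun s _ => ?_
  -- The conjugate Jacobian is antiholomorphic, so `∂/∂zⁱ` kills it and no first-order term in `F`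
  -- survives.
  rw [wirtinger_mul (hJ s) (hBc s), wirtinger_conj,
    wirtingerBar_eq_zero (differentiableAt_jacobian hτ s j), wirtinger_comp hτd (hB s),
    map_zero, zero_mul, zero_add, Finset.mul_sum]
  exact Finset.sum_congr rfl fun r _ => by ring

end Holomorphic

/-! ### Real functions and second-order conditions at a maximum -/

section RealFunctions

variable {u : C2 → ℝ}

lemma fderiv_ofReal_apply (hu : DifferentiableAt ℝ u z) (v : C2) :
    fderiv ℝ (fun w => (u w : ℂ)) z v = ((fderiv ℝ u z v : ℝ) : ℂ) := by
  have h : HasFDerivAt (fun w => (u w : ℂ)) (Complex.ofRealCLM.comp (fderiv ℝ u z)) z :=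
    Complex.ofRealCLM.hasFDerivAt.comp z hu.hasFDerivAt
  rw [h.fderiv]
  rfl

lemma _root_.ContDiffAt.ofReal_comp {n : ℕ∞ω} (hu : ContDiffAt ℝ n u z) :
    ContDiffAt ℝ n (fun w => (u w : ℂ)) z :=
  Complex.ofRealCLM.contDiff.contDiffAt.comp z hu

lemma wirtingerBar_ofReal : wirtingerBar i (fun w => (u w : ℂ)) z
    = conj (wirtinger i (fun w => (u w : ℂ)) z) := by
  rw [← wirtingerBar_conj]
  simp only [Complex.conj_ofReal]

/-- At a local maximum the second derivative in every direction is nonpositive. -/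
lemma fderiv_fderiv_nonpos_of_isLocalMax (hu : ContDiffAt ℝ 2 u z) (hmax : IsLocalMax u z)
    (v : C2) : fderiv ℝ (fun w => fderiv ℝ u w v) z v ≤ 0 := by
  set h : ℝ → ℝ := fun t => u (z + t • v) with hh
  have hline (t : ℝ) : HasDerivAt (fun t : ℝ => z + t • v) v t := by
    simpa using ((hasDerivAt_id t).smul_const v).const_add z
  have h0 : z + (0 : ℝ) • v = z := by simp
  have hcont : Tendsto (fun t : ℝ => z + t • v) (𝓝 0) (𝓝 z) := by
    have := (hline 0).continuousAt.tendsto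
    rwa [h0] at this
  have hd : deriv h =ᶠ[𝓝 0] fun t => fderiv ℝ u (z + t • v) v := by
    have : ∀ᶠ w in 𝓝 z, ContDiffAt ℝ 2 u w := hu.eventually (by simp)
    filter_upwards [hcont.eventually this] with t ht
    exact ((ht.differentiableAt (by norm_num)).hasFDerivAt.comp_hasDerivAt t (hline t)).deriv
  have hdd : HasDerivAt (deriv h) (fderiv ℝ (fun w => fderiv ℝ u w v) z v) 0 := by
    have h1 : DifferentiableAt ℝ (fun w => fderiv ℝ u w v) (z + (0 : ℝ) • v) := by
      rw [h0]
      exact ((hu.fderiv_right (m := 1) (by norm_num)).clm_apply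
        contDiffAt_const).differentiableAt (by norm_num)
    have h2 := h1.hasFDerivAt.comp_hasDerivAt (0 : ℝ) (hline 0)
    rw [h0] at h2
    exact h2.congr_of_eventuallyEq hd
  have hmax' : IsLocalMax h 0 := by
    have := hcont.eventually hmax
    filter_upwards [this] with t ht
    simpa [hh] using ht
  -- A positive second derivative would make `0` a local minimum as well, so `h` would be locally
  -- constant and its second derivative zero.
  by_contra! hpos
  have hcontAt : ContinuousAt h 0 := by
    have : ContinuousAt u (z + (0 : ℝ) • v) := by rw [h0]; exact hu.continuousAt
    exact ContinuousAt.comp (g := u) (f := fun t : ℝ => z + t • v) this (hline 0).continuousAt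
  have hmin : IsLocalMin h 0 :=
    isLocalMin_of_deriv_deriv_pos (by rw [hdd.deriv]; exact hpos) hmax'.deriv_eq_zero hcontAt
  have hconst : h =ᶠ[𝓝 0] fun _ => h 0 := by
    filter_upwards [hmin, hmax'] with t h1 h2 using le_antisymm h2 h1
  have h3 : deriv (deriv h) 0 = 0 := by
    rw [hconst.deriv.deriv_eq]
    simp
  rw [hdd.deriv] at h3
  exact hpos.ne' h3

lemma wirtinger_eq_zero_of_isLocalMax (hu : DifferentiableAt ℝ u z) (hmax : IsLocalMax u z) :
    wirtinger i (fun w => (u w : ℂ)) z = 0 := by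
  simp [wirtinger, fderiv_ofReal_apply hu, hmax.fderiv_eq_zero]

/-- The diagonal entry is a quarter of the Euclidean Laplacian in the real plane of `zⁱ`. -/
lemma re_wirtinger_wirtingerBar_nonpos (hu : ContDiffAt ℝ 2 u z) (hmax : IsLocalMax u z) :
    (wirtinger i (wirtingerBar i fun w => (u w : ℂ)) z).re ≤ 0 := by
  have hev (v : C2) : (fun x => fderiv ℝ (fun w => (u w : ℂ)) x v) =ᶠ[𝓝 z]
      fun x => ((fderiv ℝ u x v : ℝ) : ℂ) := by
    have : ∀ᶠ w in 𝓝 z, ContDiffAt ℝ 2 u w := hu.eventually (by simp)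
    filter_upwards [this] with w hw
    exact fderiv_ofReal_apply (hw.differentiableAt (by norm_num)) v
  have hD (v : C2) : DifferentiableAt ℝ (fun x => fderiv ℝ u x v) z :=
    ((hu.fderiv_right (m := 1) (by norm_num)).clm_apply
        contDiffAt_const).differentiableAt (by norm_num)
  have h1 := fderiv_fderiv_nonpos_of_isLocalMax hu hmax (dx i)
  have h2 := fderiv_fderiv_nonpos_of_isLocalMax hu hmax (dy i)
  rw [wirtinger, fderiv_wirtingerBar hu.ofReal_comp, fderiv_wirtingerBar hu.ofReal_comp,
    (hev (dx i)).fderiv_eq, (hev (dy i)).fderiv_eq]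
  simp only [fderiv_ofReal_apply (hD _)]
  simp
  linarith

end RealFunctions

end WirtingerCalculus

/-! ### Closed `(1,1)`-forms and the pointwise identity -/

section LocalEstimate

variable {F G : C2 → ℂ} {z : C2} {i j : Fin 2}

lemma wirtinger_wirtingerBar_add (hF : ContDiffAt ℝ 2 F z) (hG : ContDiffAt ℝ 2 G z) :
    wirtinger i (wirtingerBar j fun w => F w + G w) z
      = wirtinger i (wirtingerBar j F) z + wirtinger i (wirtingerBar j G) z := by
  have hev : wirtingerBar j (fun w => F w + G w) =ᶠ[𝓝 z]
      fun w => wirtingerBar j F w + wirtingerBar j G w := by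
    filter_upwards [hF.eventually (by simp), hG.eventually (by simp)] with w h1 h2
    exact wirtingerBar_add (h1.differentiableAt (by norm_num)) (h2.differentiableAt (by norm_num))
  rw [hev.wirtinger_eq, wirtinger_add]
  · exact (hF.wirtingerBar (m := 1) (by norm_num)).differentiableAt (by norm_num)
  · exact (hG.wirtingerBar (m := 1) (by norm_num)).differentiableAt (by norm_num)

lemma wirtinger_wirtingerBar_sub (hF : ContDiffAt ℝ 2 F z) (hG : ContDiffAt ℝ 2 G z) :
    wirtinger i (wirtingerBar j fun w => F w - G w) z
      = wirtinger i (wirtingerBar j F) z - wirtinger i (wirtingerBar j G) z := by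
  have hev : wirtingerBar j (fun w => F w - G w) =ᶠ[𝓝 z]
      fun w => wirtingerBar j F w - wirtingerBar j G w := by
    filter_upwards [hF.eventually (by simp), hG.eventually (by simp)] with w h1 h2
    exact wirtingerBar_sub (h1.differentiableAt (by norm_num)) (h2.differentiableAt (by norm_num))
  rw [hev.wirtinger_eq, wirtinger_sub]
  · exact (hF.wirtingerBar (m := 1) (by norm_num)).differentiableAt (by norm_num)
  · exact (hG.wirtingerBar (m := 1) (by norm_num)).differentiableAt (by norm_num)

lemma wirtinger_wirtingerBar_mul (hF : ContDiffAt ℝ 2 F z) (hG : ContDiffAt ℝ 2 G z) :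
    wirtinger i (wirtingerBar j fun w => F w * G w) z
      = wirtinger i (wirtingerBar j F) z * G z + wirtinger i F z * wirtingerBar j G z
        + wirtingerBar j F z * wirtinger i G z + F z * wirtinger i (wirtingerBar j G) z := by
  have hev : wirtingerBar j (fun w => F w * G w) =ᶠ[𝓝 z]
      fun w => wirtingerBar j F w * G w + F w * wirtingerBar j G w := by
    filter_upwards [hF.eventually (by simp), hG.eventually (by simp)] with w h1 h2
    exact wirtingerBar_mul (h1.differentiableAt (by norm_num)) (h2.differentiableAt (by norm_num))
  have hF1 : DifferentiableAt ℝ F z := hF.differentiableAt (by norm_num)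
  have hG1 : DifferentiableAt ℝ G z := hG.differentiableAt (by norm_num)
  have hF2 : DifferentiableAt ℝ (wirtingerBar j F) z :=
    (hF.wirtingerBar (m := 1) (by norm_num)).differentiableAt (by norm_num)
  have hG2 : DifferentiableAt ℝ (wirtingerBar j G) z :=
    (hG.wirtingerBar (m := 1) (by norm_num)).differentiableAt (by norm_num)
  rw [hev.wirtinger_eq, wirtinger_add (hF2.fun_mul hG1) (hF1.fun_mul hG2), wirtinger_mul hF2 hG1,
    wirtinger_mul hF1 hG2]
  ring

/-- The germ at `z` of a matrix-valued function is that of a closed Hermitian form of type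
`(1,1)` and class `C²`. -/
structure IsKahlerAt (G : C2 → Matrix (Fin 2) (Fin 2) ℂ) (z : C2) : Prop where
  contDiffAt : ∀ i j, ContDiffAt ℝ 2 (fun w => G w i j) z
  isHermitian : ∀ᶠ w in 𝓝 z, (G w).IsHermitian
  closed : ∀ᶠ w in 𝓝 z, ∀ i j k,
    wirtinger k (fun x => G x i j) w = wirtinger i (fun x => G x k j) w

namespace IsKahlerAt

variable {G : C2 → Matrix (Fin 2) (Fin 2) ℂ} {z : C2}

lemma eventually (h : IsKahlerAt G z) : ∀ᶠ w in 𝓝 z, IsKahlerAt G w := by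
  have h1 : ∀ᶠ w in 𝓝 z, ∀ i j, ContDiffAt ℝ 2 (fun w => G w i j) w := by
    simp only [eventually_all]
    exact fun i j => (h.contDiffAt i j).eventually (by simp)
  filter_upwards [h1, h.isHermitian.eventually_nhds, h.closed.eventually_nhds] with w a b c
  exact ⟨a, b, c⟩

lemma wirtingerBar_apply (h : IsKahlerAt G z) (i j k : Fin 2) :
    wirtingerBar k (fun x => G x i j) z = conj (wirtinger k (fun x => G x j i) z) := by
  rw [← wirtingerBar_conj]
  refine EventuallyEq.wirtingerBar_eq ?_
  filter_upwards [h.isHermitian] with w hw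
  exact (hw.apply i j).symm

lemma wirtingerBar_closed (h : IsKahlerAt G z) (i j k : Fin 2) :
    wirtingerBar k (fun x => G x i j) z = wirtingerBar j (fun x => G x i k) z := by
  rw [h.wirtingerBar_apply, h.wirtingerBar_apply, h.closed.self_of_nhds]

/-- Closedness in the unbarred indices, its conjugate in the barred ones, and commutation of mixed
derivatives together allow both pairs of indices to be exchanged. In dimension two this identifies
`∂₁∂̄₁ G₂₂̄` with `∂₂∂̄₂ G₁₁̄`. -/
lemma wirtinger_wirtingerBar_closed (h : IsKahlerAt G z) (i j k l : Fin 2) :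
    wirtinger k (wirtingerBar l fun x => G x i j) z
      = wirtinger i (wirtingerBar j fun x => G x k l) z := by
  have h1 : wirtingerBar l (fun x => G x i j) =ᶠ[𝓝 z] wirtingerBar j (fun x => G x i l) := by
    filter_upwards [h.eventually] with w hw using hw.wirtingerBar_closed i j l
  have h2 : wirtinger k (fun x => G x i l) =ᶠ[𝓝 z] wirtinger i (fun x => G x k l) := by
    filter_upwards [h.closed] with w hw using hw i l k
  rw [h1.wirtinger_eq, wirtinger_wirtingerBar_comm (h.contDiffAt i l), h2.wirtingerBar_eq,
    wirtinger_wirtingerBar_comm (h.contDiffAt k l)]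

lemma add {H : C2 → Matrix (Fin 2) (Fin 2) ℂ} (h : IsKahlerAt G z) (h' : IsKahlerAt H z) :
    IsKahlerAt (fun w => G w + H w) z where
  contDiffAt i j := (h.contDiffAt i j).add (h'.contDiffAt i j)
  isHermitian := by
    filter_upwards [h.isHermitian, h'.isHermitian] with w a b using a.add b
  closed := by
    filter_upwards [h.eventually, h'.eventually] with w a b i j k
    have ha (i j) := (a.contDiffAt i j).differentiableAt (by norm_num)
    have hb (i j) := (b.contDiffAt i j).differentiableAt (by norm_num)
    simp only [Matrix.add_apply]
    rw [wirtinger_add (ha _ _) (hb _ _), wirtinger_add (ha _ _) (hb _ _),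
      a.closed.self_of_nhds, b.closed.self_of_nhds]

end IsKahlerAt

lemma isHermitian_complexHessian {u : C2 → ℝ} (hu : ContDiffAt ℝ 2 u z) :
    (complexHessian u z).IsHermitian := by
  ext i j
  have hev : wirtinger j (fun w => (u w : ℂ))
      = fun w => conj (wirtingerBar j (fun w => (u w : ℂ)) w) := by
    ext w
    rw [wirtingerBar_ofReal, Complex.conj_conj]
  simp only [Matrix.conjTranspose_apply, complexHessian, Matrix.of_apply, RCLike.star_def]
  rw [wirtinger_wirtingerBar_comm hu.ofReal_comp, hev, wirtingerBar_conj, Complex.conj_conj]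

lemma isKahlerAt_complexHessian {u : C2 → ℝ} (hu : ContDiffAt ℝ 4 u z) :
    IsKahlerAt (complexHessian u) z where
  contDiffAt i j := (hu.ofReal_comp.wirtingerBar (m := 3) (by norm_num)).wirtinger (by norm_num)
  isHermitian := by
    filter_upwards [hu.eventually (by simp)] with w hw
    exact isHermitian_complexHessian (hw.of_le (by norm_num))
  closed := by
    filter_upwards [hu.eventually (by simp)] with w hw i j k
    exact wirtinger_comm ((hw.ofReal_comp.wirtingerBar (m := 3) (by norm_num)).of_le (by norm_num))

/-- Commutation of the linearised Monge–Ampère operator with the trace, as an identity between the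
Taylor coefficients at a point where the metric is the identity and the second form is diagonal.
Here `c`, `d` are the first derivatives of the two forms and `cb`, `db` their conjugates. -/
lemma trace_sub_laplacian_identity
    {a b c111 c112 c121 c122 c212 c222 cb111 cb112 cb121 cb122 cb212 cb222
      d111 d112 d121 d122 d212 d222 db111 db112 db121 db122 db212 db222
      g11 g12 g22 h11 h12 h22 T1 T2 Tb1 Tb2 T11 T22 f1 f2 fb1 fb2 f11 f22 : ℂ}
    (hT1 : T1 = c122 * a + d111 + c111 * b + d122 - (a + b) * (c111 + c122))
    (hTb1 : Tb1 = cb122 * a + db111 + cb111 * b + db122 - (a + b) * (cb111 + cb122))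
    (hT2 : T2 = c222 * a + d112 + c112 * b + d222 - (a + b) * (c112 + c222))
    (hTb2 : Tb2 = cb222 * a + db112 + cb112 * b + db222 - (a + b) * (cb112 + cb222))
    (hf1 : f1 = b * d111 + a * d122 - a * b * (c111 + c122))
    (hfb1 : fb1 = b * db111 + a * db122 - a * b * (cb111 + cb122))
    (hf2 : f2 = b * d112 + a * d222 - a * b * (c112 + c222))
    (hfb2 : fb2 = b * db112 + a * db222 - a * b * (cb112 + cb222))
    (hT11 : T11 + T1 * (cb111 + cb122) + Tb1 * (c111 + c122)
        + (a + b) * (g11 + g12 + c111 * cb122 + cb111 * c122 - c121 * cb121 - c112 * cb112)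
      = g12 * a + c122 * db111 + cb122 * d111 + h11 + g11 * b + c111 * db122 + cb111 * d122 + h12
        - (c121 * db121 + cb112 * d112) - (c112 * db112 + cb121 * d121))
    (hT22 : T22 + T2 * (cb112 + cb222) + Tb2 * (c112 + c222)
        + (a + b) * (g12 + g22 + c112 * cb222 + cb112 * c222 - c122 * cb122 - c212 * cb212)
      = g22 * a + c222 * db112 + cb222 * d112 + h12 + g12 * b + c112 * db222 + cb112 * d222 + h22
        - (c122 * db122 + cb212 * d212) - (c212 * db212 + cb122 * d122))
    (hf11 : f11 + f1 * (cb111 + cb122) + fb1 * (c111 + c122)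
        + a * b * (g11 + g12 + c111 * cb122 + cb111 * c122 - c121 * cb121 - c112 * cb112)
      = b * h11 + a * h12 + d111 * db122 + db111 * d122 - d121 * db121 - d112 * db112)
    (hf22 : f22 + f2 * (cb112 + cb222) + fb2 * (c112 + c222)
        + a * b * (g12 + g22 + c112 * cb222 + cb112 * c222 - c122 * cb122 - c212 * cb212)
      = b * h12 + a * h22 + d112 * db222 + db112 * d222 - d122 * db122 - d212 * db212) :
    b * T11 + a * T22 - (f11 + f22) = (a - b) ^ 2 * (c112 * cb112 + c122 * cb122 - g12)
      + (d121 - b * c121) * (db121 - b * cb121) + (d212 - a * c212) * (db212 - a * cb212)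
      + (d112 - a * c112) * (db112 - a * cb112) + (d122 - b * c122) * (db122 - b * cb122)
      - ((d111 - a * c111) * (db122 - b * cb122) + (db111 - a * cb111) * (d122 - b * c122))
      - ((d112 - a * c112) * (db222 - b * cb222) + (db112 - a * cb112) * (d222 - b * c222)) := by
  -- Each hypothesis is solved for its second derivative of `T` or `f`. The second derivatives of
  -- the second form then enter both sides only as `b h11 + (a + b) h12 + a h22` and cancel; `g11`
  -- and `g22` cancel too, and `g12` keeps the coefficient `-(a - b)²`.
  rw [← eq_sub_iff_add_eq, ← eq_sub_iff_add_eq, ← eq_sub_iff_add_eq] at hT11 hT22 hf11 hf22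
  rw [hT11, hT22, hf11, hf22, hT1, hT2, hTb1, hTb2, hf1, hf2, hfb1, hfb2]
  ring

/-- The trace of the adjugate of the first matrix times the second one. -/
def mixedDet (G G' : Matrix (Fin 2) (Fin 2) ℂ) : ℂ :=
  G 1 1 * G' 0 0 + G 0 0 * G' 1 1 - G 0 1 * G' 1 0 - G 1 0 * G' 0 1

/-- The difference of the two sides is a sum of squares, displayed in `key`. In the application `x +
v` is a derivative of `T` and `b x + a v` the same derivative of `f`; the latter term compensates
for the indefinite `-2 Re (x v̄)`. -/
lemma normSq_add_div_le {a b : ℝ} (ha : 0 < a) (hb : 0 < b) (x v : ℂ) :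
    b * Complex.normSq (x + v) / (a + b)
      ≤ Complex.normSq v - 2 * (x * conj v).re + Complex.normSq (b * x + a * v) / (a * b) := by
  have key : Complex.normSq v - 2 * (x * conj v).re + Complex.normSq (b * x + a * v) / (a * b)
      - b * Complex.normSq (x + v) / (a + b)
      = (b * Complex.normSq (b * x - a * v) + a ^ 2 * (a + b) * Complex.normSq v)
        / (a * b * (a + b)) := by
    simp only [Complex.normSq_apply, Complex.add_re, Complex.add_im, Complex.mul_re,
      Complex.mul_im, Complex.conj_re, Complex.conj_im, Complex.ofReal_re, Complex.ofReal_im,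
      Complex.sub_re, Complex.sub_im]
    field_simp
    ring
  have : 0 ≤ (b * Complex.normSq (b * x - a * v) + a ^ 2 * (a + b) * Complex.normSq v)
        / (a * b * (a + b)) := by
    have := Complex.normSq_nonneg (b * x - a * v)
    have := Complex.normSq_nonneg v
    positivity
  linarith

end LocalEstimate

/-! ### The maximum principle at one point -/

section LocalEstimate

variable {z : C2}

/-- Second-order conditions for a maximum of `T * exp (-lam * φ)`. -/
lemma hessian_le_of_isLocalMax {T φ : C2 → ℝ} {lam : ℝ} (hT : ContDiffAt ℝ 2 T z)
    (hφ : ContDiffAt ℝ 2 φ z) (hTpos : 0 < T z)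
    (hmax : IsLocalMax (fun w => T w * Real.exp (-lam * φ w)) z) (k : Fin 2) :
    (wirtinger k (wirtingerBar k fun w => (T w : ℂ)) z).re
      ≤ lam * T z * (wirtinger k (wirtingerBar k fun w => (φ w : ℂ)) z).re
        + Complex.normSq (wirtinger k (fun w => (T w : ℂ)) z) / T z := by
  -- The maximum of the product says that `T` lies below `T z * E` with equality at `z`. Hence `T -
  -- T z * E` has a local maximum there, and its first-order condition turns `|E_k|²` into `|T_k|² /
  -- T²`.
  set E : C2 → ℝ := fun w => Real.exp (lam * (φ w - φ z)) with hE
  have hEz : E z = 1 := by simp [hE]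
  have hEd : ContDiffAt ℝ 2 E z := (contDiffAt_const.mul (hφ.sub contDiffAt_const)).exp
  set u : C2 → ℝ := fun w => T w - T z * E w with hu
  have hud : ContDiffAt ℝ 2 u z := hT.sub (contDiffAt_const.mul hEd)
  have humax : IsLocalMax u z := by
    filter_upwards [hmax] with w hw
    have h1 : E w = Real.exp (lam * φ w) * Real.exp (-lam * φ z) := by
      rw [← Real.exp_add]; simp only [hE]; congr 1; ring
    have h2 : T w = T w * Real.exp (-lam * φ w) * Real.exp (lam * φ w) := by
      rw [mul_assoc, ← Real.exp_add]; simp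
    have h3 := mul_le_mul_of_nonneg_right hw (Real.exp_pos (lam * φ w)).le
    rw [← h2] at h3
    simp only [hu, hEz, h1]
    linarith
  have hEbar (w : C2) (hw : ContDiffAt ℝ 2 φ w) (k : Fin 2) :
      wirtinger k (fun w => (E w : ℂ)) w = (E w : ℂ) * (lam * wirtinger k (fun w => (φ w : ℂ)) w)
      ∧ wirtingerBar k (fun w => (E w : ℂ)) w
        = (E w : ℂ) * (lam * wirtingerBar k (fun w => (φ w : ℂ)) w) := by
    have hφw : DifferentiableAt ℝ φ w := hw.differentiableAt (by norm_num)
    have hEw : HasFDerivAt E (E w • (lam • fderiv ℝ φ w)) w :=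
      ((hφw.hasFDerivAt.sub_const (φ z)).const_mul lam).exp
    simp only [wirtinger, wirtingerBar, fderiv_ofReal_apply hφw,
      fderiv_ofReal_apply hEw.differentiableAt, hEw.fderiv]
    constructor <;> (simp; ring)
  have hev : wirtingerBar k (fun w => (E w : ℂ)) =ᶠ[𝓝 z]
      fun w => (E w : ℂ) * (lam * wirtingerBar k (fun w => (φ w : ℂ)) w) := by
    filter_upwards [hφ.eventually (by simp)] with w hw using (hEbar w hw k).2
  have hφc := hφ.ofReal_comp
  have hEc := hEd.ofReal_comp
  have hTc := hT.ofReal_comp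
  have hφb : DifferentiableAt ℝ (wirtingerBar k (fun w => (φ w : ℂ))) z :=
    (hφc.wirtingerBar (m := 1) (by norm_num)).differentiableAt (by norm_num)
  have hE2 : wirtinger k (wirtingerBar k fun w => (E w : ℂ)) z
      = lam * wirtinger k (wirtingerBar k fun w => (φ w : ℂ)) z
        + wirtinger k (fun w => (E w : ℂ)) z * conj (wirtinger k (fun w => (E w : ℂ)) z) := by
    rw [hev.wirtinger_eq, wirtinger_mul (hEc.differentiableAt (by norm_num)) (hφb.const_mul _),
      wirtinger_mul (differentiableAt_const _) hφb, wirtinger_const, (hEbar z hφ k).1,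
      wirtingerBar_ofReal]
    simp [hEz]
    ring
  have hc : ContDiffAt ℝ 2 (fun _ : C2 => ((T z : ℝ) : ℂ)) z := contDiffAt_const
  have hu1 : (fun w => (u w : ℂ)) = fun w => (T w : ℂ) - (T z : ℂ) * (E w : ℂ) := by
    ext w; simp [hu]
  have h1 := wirtinger_eq_zero_of_isLocalMax (i := k) (hud.differentiableAt (by norm_num)) humax
  have h2 := re_wirtinger_wirtingerBar_nonpos (i := k) hud humax
  rw [hu1, wirtinger_sub (hTc.differentiableAt (by norm_num))
    ((hc.mul hEc).differentiableAt (by norm_num)), wirtinger_mul (hc.differentiableAt (by norm_num))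
    (hEc.differentiableAt (by norm_num)), wirtinger_const, zero_mul, zero_add] at h1
  have hb0 : wirtingerBar k (fun _ : C2 => ((T z : ℝ) : ℂ)) = fun _ => 0 := by
    ext w; exact wirtingerBar_const _
  rw [hu1, wirtinger_wirtingerBar_sub hTc (hc.mul hEc), wirtinger_wirtingerBar_mul hc hEc,
    wirtinger_const, hb0, wirtinger_const, hE2, Complex.mul_conj] at h2
  rw [sub_eq_zero] at h1
  rw [h1, Complex.normSq_mul, Complex.normSq_ofReal]
  simp only [Complex.sub_re, Complex.add_re, Complex.mul_re, Complex.ofReal_re,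
    Complex.ofReal_im, zero_mul, sub_zero, zero_add] at h2
  have : T z * T z * Complex.normSq (wirtinger k (fun w => (E w : ℂ)) z) / T z
      = T z * Complex.normSq (wirtinger k (fun w => (E w : ℂ)) z) := by
    field_simp
  rw [this]
  linarith

/-- The maximum principle estimate at a point where the metric is the identity and the second
form is diagonal. -/
theorem quadratic_estimate_of_isLocalMax {G G' : C2 → Matrix (Fin 2) (Fin 2) ℂ}
    {f T φ : C2 → ℝ} {a b lam A K C : ℝ} (hG : IsKahlerAt G z) (hG' : IsKahlerAt G' z)
    (hfd : ContDiffAt ℝ 2 f z) (hTd : ContDiffAt ℝ 2 T z) (hφ : ContDiffAt ℝ 2 φ z)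
    (hf : ∀ᶠ w in 𝓝 z, (f w : ℂ) * (G w).det = (G' w).det)
    (hT : ∀ᶠ w in 𝓝 z, (T w : ℂ) * (G w).det = mixedDet (G w) (G' w))
    (hGz : G z = 1) (hG'z : G' z = Matrix.diagonal ![(a : ℂ), (b : ℂ)]) (ha : 0 < a) (hb : 0 < b)
    (hφk : ∀ k, wirtinger k (wirtingerBar k fun w => (φ w : ℂ)) z = G' z k k - G z k k)
    (hmax : IsLocalMax (fun w => T w * Real.exp (-lam * φ w)) z)
    (hlap : -A ≤ (∑ k, wirtinger k (wirtingerBar k fun w => (f w : ℂ)) z).re)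
    (hgrad : ∑ k, Complex.normSq (wirtinger k (fun w => (f w : ℂ)) z) ≤ K * f z)
    (hcurv : (wirtinger 1 (wirtingerBar 1 fun w => G w 0 0) z).re ≤ C) (hC : 0 ≤ C) :
    (lam - C) * (a + b) ^ 2 ≤ A + K + 2 * lam * (a * b) * (a + b) := by
  have hgd (i j) := hG.contDiffAt i j
  have hhd (i j) := hG'.contDiffAt i j
  have hg1 (i j) : DifferentiableAt ℝ (fun w => G w i j) z :=
    (hgd i j).differentiableAt (by norm_num)
  have hh1 (i j) : DifferentiableAt ℝ (fun w => G' w i j) z :=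
    (hhd i j).differentiableAt (by norm_num)
  have hgv00 : G z 0 0 = 1 := by simp [hGz]
  have hgv01 : G z 0 1 = 0 := by simp [hGz]
  have hgv10 : G z 1 0 = 0 := by simp [hGz]
  have hgv11 : G z 1 1 = 1 := by simp [hGz]
  have hhv00 : G' z 0 0 = a := by simp [hG'z]
  have hhv01 : G' z 0 1 = 0 := by simp [hG'z]
  have hhv10 : G' z 1 0 = 0 := by simp [hG'z]
  have hhv11 : G' z 1 1 = b := by simp [hG'z]
  have hfz : f z = a * b := by
    have := hf.self_of_nhds
    rw [hGz, hG'z] at this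
    simp at this
    exact_mod_cast this
  have hTz : T z = a + b := by
    have := hT.self_of_nhds
    rw [mixedDet, hGz, hG'z] at this
    simp at this
    exact_mod_cast this
  have hTpos : 0 < T z := by rw [hTz]; positivity
  simp only [Matrix.det_fin_two, mixedDet] at hf hT
  have hfc := hfd.ofReal_comp
  have hTc := hTd.ofReal_comp
  have hf1 := hfc.differentiableAt (n := 2) (by norm_num)
  have hT1 := hTc.differentiableAt (n := 2) (by norm_num)
  have gc := hG.closed.self_of_nhds
  have hc := hG'.closed.self_of_nhds
  have gcc : wirtinger 0 (wirtingerBar 0 fun w => G w 1 1) z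
      = wirtinger 1 (wirtingerBar 1 fun w => G w 0 0) z := hG.wirtinger_wirtingerBar_closed 1 1 0 0
  have hcc : wirtinger 0 (wirtingerBar 0 fun w => G' w 1 1) z
      = wirtinger 1 (wirtingerBar 1 fun w => G' w 0 0) z :=
    hG'.wirtinger_wirtingerBar_closed 1 1 0 0
  -- first derivatives of the two scalar identities
  have hdetd : ContDiffAt ℝ 2 (fun w => G w 0 0 * G w 1 1 - G w 0 1 * G w 1 0) z :=
    ((hgd 0 0).mul (hgd 1 1)).sub ((hgd 0 1).mul (hgd 1 0))
  have det1 (k : Fin 2) : wirtinger k (fun w => G w 0 0 * G w 1 1 - G w 0 1 * G w 1 0) z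
      = wirtinger k (fun w => G w 0 0) z + wirtinger k (fun w => G w 1 1) z := by
    rw [wirtinger_sub ((hg1 0 0).fun_mul (hg1 1 1)) ((hg1 0 1).fun_mul (hg1 1 0)),
      wirtinger_mul (hg1 0 0) (hg1 1 1), wirtinger_mul (hg1 0 1) (hg1 1 0), hgv00, hgv01, hgv10,
      hgv11]
    ring
  have detb1 (k : Fin 2) : wirtingerBar k (fun w => G w 0 0 * G w 1 1 - G w 0 1 * G w 1 0) z
      = conj (wirtinger k (fun w => G w 0 0) z) + conj (wirtinger k (fun w => G w 1 1) z) := by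
    rw [wirtingerBar_sub ((hg1 0 0).fun_mul (hg1 1 1)) ((hg1 0 1).fun_mul (hg1 1 0)),
      wirtingerBar_mul (hg1 0 0) (hg1 1 1), wirtingerBar_mul (hg1 0 1) (hg1 1 0), hgv00, hgv01,
      hgv10, hgv11, hG.wirtingerBar_apply, hG.wirtingerBar_apply]
    ring
  -- The two scalar identities hold near `z`, so they may be differentiated there. Keeping `det G`
  -- on the left avoids differentiating an inverse matrix.
  have ef1 (k : Fin 2) := EventuallyEq.wirtinger_eq (i := k) hf
  have eT1 (k : Fin 2) := EventuallyEq.wirtinger_eq (i := k) hT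
  have ef2 (k : Fin 2) := EventuallyEq.wirtinger_eq (i := k) (EventuallyEq.wirtingerBar (i := k) hf)
  have eT2 (k : Fin 2) := EventuallyEq.wirtinger_eq (i := k) (EventuallyEq.wirtingerBar (i := k) hT)
  simp only [wirtinger_mul hf1 (hdetd.differentiableAt (by norm_num)), det1,
    wirtinger_sub ((hh1 0 0).fun_mul (hh1 1 1)) ((hh1 0 1).fun_mul (hh1 1 0)),
    wirtinger_mul (hh1 0 0) (hh1 1 1), wirtinger_mul (hh1 0 1) (hh1 1 0), hgv00, hgv01, hgv10,
    hgv11, hhv00, hhv01, hhv10, hhv11, mul_zero, zero_mul, sub_zero, add_zero, mul_one] at ef1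
  simp only [wirtinger_mul hT1 (hdetd.differentiableAt (by norm_num)), det1,
    wirtinger_sub ((((hg1 1 1).fun_mul (hh1 0 0)).fun_add ((hg1 0 0).fun_mul (hh1 1 1))).fun_sub
      ((hg1 0 1).fun_mul (hh1 1 0))) ((hg1 1 0).fun_mul (hh1 0 1)),
    wirtinger_sub (((hg1 1 1).fun_mul (hh1 0 0)).fun_add ((hg1 0 0).fun_mul (hh1 1 1)))
      ((hg1 0 1).fun_mul (hh1 1 0)),
    wirtinger_add ((hg1 1 1).fun_mul (hh1 0 0)) ((hg1 0 0).fun_mul (hh1 1 1)),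
    wirtinger_mul (hg1 1 1) (hh1 0 0), wirtinger_mul (hg1 0 0) (hh1 1 1),
    wirtinger_mul (hg1 0 1) (hh1 1 0), wirtinger_mul (hg1 1 0) (hh1 0 1), hgv00, hgv01, hgv10,
    hgv11, hhv00, hhv01, hhv10, hhv11, mul_zero, zero_mul, sub_zero, add_zero, mul_one,
    one_mul] at eT1
  simp only [wirtinger_wirtingerBar_mul hfc hdetd, det1, detb1,
    wirtinger_wirtingerBar_sub ((hgd 0 0).mul (hgd 1 1)) ((hgd 0 1).mul (hgd 1 0)),
    wirtinger_wirtingerBar_mul (hgd 0 0) (hgd 1 1), wirtinger_wirtingerBar_mul (hgd 0 1) (hgd 1 0),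
    wirtinger_wirtingerBar_sub ((hhd 0 0).mul (hhd 1 1)) ((hhd 0 1).mul (hhd 1 0)),
    wirtinger_wirtingerBar_mul (hhd 0 0) (hhd 1 1), wirtinger_wirtingerBar_mul (hhd 0 1) (hhd 1 0),
    hG.wirtingerBar_apply, hG'.wirtingerBar_apply, wirtingerBar_ofReal,
    hgv00, hgv01, hgv10, hgv11, hhv00, hhv01, hhv10, hhv11, mul_zero, zero_mul, sub_zero, add_zero,
    mul_one, one_mul, zero_add] at ef2
  simp only [wirtinger_wirtingerBar_mul hTc hdetd, det1, detb1,
    wirtinger_wirtingerBar_sub ((hgd 0 0).mul (hgd 1 1)) ((hgd 0 1).mul (hgd 1 0)),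
    wirtinger_wirtingerBar_mul (hgd 0 0) (hgd 1 1), wirtinger_wirtingerBar_mul (hgd 0 1) (hgd 1 0),
    wirtinger_wirtingerBar_sub ((((hgd 1 1).mul (hhd 0 0)).add ((hgd 0 0).mul (hhd 1 1))).sub
      ((hgd 0 1).mul (hhd 1 0))) ((hgd 1 0).mul (hhd 0 1)),
    wirtinger_wirtingerBar_sub (((hgd 1 1).mul (hhd 0 0)).add ((hgd 0 0).mul (hhd 1 1)))
      ((hgd 0 1).mul (hhd 1 0)),
    wirtinger_wirtingerBar_add ((hgd 1 1).mul (hhd 0 0)) ((hgd 0 0).mul (hhd 1 1)),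
    wirtinger_wirtingerBar_mul (hgd 1 1) (hhd 0 0), wirtinger_wirtingerBar_mul (hgd 0 0) (hhd 1 1),
    wirtinger_wirtingerBar_mul (hgd 0 1) (hhd 1 0), wirtinger_wirtingerBar_mul (hgd 1 0) (hhd 0 1),
    hG.wirtingerBar_apply, hG'.wirtingerBar_apply, wirtingerBar_ofReal,
    hgv00, hgv01, hgv10, hgv11, hhv00, hhv01, hhv10, hhv11, mul_zero, zero_mul, sub_zero, add_zero,
    mul_one, one_mul, zero_add] at eT2
  have mT1 := hessian_le_of_isLocalMax hTd hφ hTpos hmax 0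
  have mT2 := hessian_le_of_isLocalMax hTd hφ hTpos hmax 1
  rw [hφk, hgv00, hhv00] at mT1
  rw [hφk, hgv11, hhv11] at mT2
  rw [Fin.sum_univ_two] at hlap hgrad
  have ef1_0 := ef1 0
  have ef1_1 := ef1 1
  have ef2_0 := ef2 0
  have ef2_1 := ef2 1
  have eT1_0 := eT1 0
  have eT1_1 := eT1 1
  have eT2_0 := eT2 0
  have eT2_1 := eT2 1
  rw [hfz] at ef1_0 ef1_1 ef2_0 ef2_1 hgrad
  rw [hTz] at eT1_0 eT1_1 eT2_0 eT2_1 mT1 mT2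
  -- Closedness expresses the derivatives `∂₁ g₂₂̄`, `∂₁ g₂₁̄`, `∂₁∂̄₁ g₂₂̄`, and those of the
  -- second form, through the variables kept in the algebraic identity.
  rw [gc 1 1 0, hc 1 1 0] at ef1_0 eT1_0 ef2_0 eT2_0
  rw [gc 1 0 0, hc 1 0 0, gcc, hcc] at ef2_0 eT2_0
  clear ef1 ef2 eT1 eT2 det1 detb1 gc hc gcc hcc hG hG' hgd hhd hg1 hh1 hmax hf hT hGz hG'z
    hφk hdetd hfc hTc hf1 hT1 hfd hTd hφ hgv00 hgv01 hgv10 hgv11 hhv00 hhv01 hhv10 hhv11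
  generalize wirtinger 0 (wirtingerBar 0 fun w => (T w : ℂ)) z = T11 at *
  generalize wirtinger 1 (wirtingerBar 1 fun w => (T w : ℂ)) z = T22 at *
  generalize wirtinger 0 (wirtingerBar 0 fun w => (f w : ℂ)) z = f11 at *
  generalize wirtinger 1 (wirtingerBar 1 fun w => (f w : ℂ)) z = f22 at *
  generalize wirtinger 0 (fun w => (T w : ℂ)) z = T1 at *
  generalize wirtinger 1 (fun w => (T w : ℂ)) z = T2 at *
  generalize wirtinger 0 (fun w => (f w : ℂ)) z = f1 at *
  generalize wirtinger 1 (fun w => (f w : ℂ)) z = f2 at *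
  generalize wirtinger 0 (fun w => G w 0 0) z = c111 at *
  generalize wirtinger 1 (fun w => G w 0 0) z = c112 at *
  generalize wirtinger 0 (fun w => G w 0 1) z = c121 at *
  generalize wirtinger 1 (fun w => G w 0 1) z = c122 at *
  generalize wirtinger 1 (fun w => G w 1 0) z = c212 at *
  generalize wirtinger 1 (fun w => G w 1 1) z = c222 at *
  generalize wirtinger 0 (fun w => G' w 0 0) z = d111 at *
  generalize wirtinger 1 (fun w => G' w 0 0) z = d112 at *
  generalize wirtinger 0 (fun w => G' w 0 1) z = d121 at *
  generalize wirtinger 1 (fun w => G' w 0 1) z = d122 at *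
  generalize wirtinger 1 (fun w => G' w 1 0) z = d212 at *
  generalize wirtinger 1 (fun w => G' w 1 1) z = d222 at *
  generalize wirtinger 0 (wirtingerBar 0 fun w => G w 0 0) z = g11 at *
  generalize wirtinger 1 (wirtingerBar 1 fun w => G w 0 0) z = g12 at *
  generalize wirtinger 1 (wirtingerBar 1 fun w => G w 1 1) z = g22 at *
  generalize wirtinger 0 (wirtingerBar 0 fun w => G' w 0 0) z = h11 at *
  generalize wirtinger 1 (wirtingerBar 1 fun w => G' w 0 0) z = h12 at *
  generalize wirtinger 1 (wirtingerBar 1 fun w => G' w 1 1) z = h22 at *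
  have hA : ((a + b : ℝ) : ℂ) = a + b := by push_cast; ring
  have hM : ((a * b : ℝ) : ℂ) = a * b := by push_cast; ring
  rw [hA] at eT1_0 eT1_1 eT2_0 eT2_1
  rw [hM] at ef1_0 ef1_1 ef2_0 ef2_1
  have ebT1_0 := congrArg conj eT1_0
  have ebT1_1 := congrArg conj eT1_1
  have ebf1_0 := congrArg conj ef1_0
  have ebf1_1 := congrArg conj ef1_1
  simp only [map_add, map_mul, Complex.conj_ofReal] at ebT1_0 ebT1_1 ebf1_0 ebf1_1
  have hid := trace_sub_laplacian_identity (a := (a : ℂ)) (b := (b : ℂ)) (c111 := c111)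
    (c112 := c112) (c121 := c121) (c122 := c122) (c212 := c212) (c222 := c222)
    (cb111 := conj c111) (cb112 := conj c112) (cb121 := conj c121) (cb122 := conj c122)
    (cb212 := conj c212) (cb222 := conj c222) (d111 := d111) (d112 := d112) (d121 := d121)
    (d122 := d122) (d212 := d212) (d222 := d222) (db111 := conj d111) (db112 := conj d112)
    (db121 := conj d121) (db122 := conj d122) (db212 := conj d212) (db222 := conj d222)
    (g11 := g11) (g12 := g12) (g22 := g22) (h11 := h11) (h12 := h12) (h22 := h22)
    (T1 := T1) (T2 := T2) (Tb1 := conj T1) (Tb2 := conj T2) (T11 := T11) (T22 := T22)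
    (f1 := f1) (f2 := f2) (fb1 := conj f1) (fb2 := conj f2) (f11 := f11) (f22 := f22)
    (by linear_combination eT1_0) (by linear_combination ebT1_0) (by linear_combination eT1_1)
    (by linear_combination ebT1_1) (by linear_combination ef1_0) (by linear_combination ebf1_0)
    (by linear_combination ef1_1) (by linear_combination ebf1_1) (by linear_combination eT2_0)
    (by linear_combination eT2_1) (by linear_combination ef2_0) (by linear_combination ef2_1)
  -- The differences `d - a c` and `d - b c` are the covariant derivatives of `g'` at the point: the
  -- Christoffel symbols there are the `c`, and `g'` is diagonal.
  have hT1 : T1 = (d111 - a * c111) + (d122 - b * c122) := by linear_combination eT1_0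
  have hT2 : T2 = (d222 - b * c222) + (d112 - a * c112) := by linear_combination eT1_1
  have hf1 : f1 = b * (d111 - a * c111) + a * (d122 - b * c122) := by linear_combination ef1_0
  have hf2 : f2 = a * (d222 - b * c222) + b * (d112 - a * c112) := by linear_combination ef1_1
  have hconj (d c : ℂ) (r : ℝ) : conj d - r * conj c = conj (d - r * c) := by simp
  simp only [hconj] at hid
  have n1 := normSq_add_div_le ha hb (d111 - a * c111) (d122 - b * c122)
  have n2 := normSq_add_div_le hb ha (d222 - b * c222) (d112 - a * c112)
  rw [← hT1, ← hf1] at n1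
  rw [← hT2, ← hf2] at n2
  generalize d111 - a * c111 = x at *
  generalize d122 - b * c122 = v at *
  generalize d112 - a * c112 = u at *
  generalize d222 - b * c222 = y at *
  generalize d121 - b * c121 = s at *
  generalize d212 - a * c212 = t at *
  have hre := congrArg Complex.re hid
  have hab : ((a : ℂ) - b) ^ 2 = (((a - b) ^ 2 : ℝ) : ℂ) := by push_cast; ring
  simp only [Complex.mul_conj, hab] at hre
  simp only [Complex.add_re, Complex.sub_re, Complex.ofReal_re,
    Complex.ofReal_im, zero_mul, sub_zero, Complex.mul_re, Complex.conj_re,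
    Complex.conj_im] at hre n1 n2 hlap
  simp only [Complex.sub_re, Complex.ofReal_re, Complex.one_re] at mT1 mT2
  have hs := Complex.normSq_nonneg s
  have ht := Complex.normSq_nonneg t
  -- The weights `b` and `a` are the cofactors of `g'`.
  have p1 := mul_le_mul_of_nonneg_left mT1 hb.le
  have p2 := mul_le_mul_of_nonneg_left mT2 ha.le
  have hgrad' : Complex.normSq f1 / (a * b) + Complex.normSq f2 / (b * a) ≤ K := by
    rw [mul_comm b a, ← add_div, div_le_iff₀ (by positivity)]
    exact hgrad
  -- The last factor is the bisectional curvature `R₁₁̄₂₂̄`. Its first-order part is a sum of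
  -- squares and can be dropped, so an upper bound on `g12` suffices without normal coordinates.
  have hcurv' : -(C * (a + b) ^ 2)
      ≤ (a - b) ^ 2 * (Complex.normSq c112 + Complex.normSq c122 - g12.re) := by
    have h1 := Complex.normSq_nonneg c112
    have h2 := Complex.normSq_nonneg c122
    have h3 : (a - b) ^ 2 ≤ (a + b) ^ 2 := by nlinarith [mul_pos ha hb]
    have h4 : (a - b) ^ 2 * (-C)
        ≤ (a - b) ^ 2 * (Complex.normSq c112 + Complex.normSq c122 - g12.re) :=
      mul_le_mul_of_nonneg_left (by linarith) (sq_nonneg _)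
    have h5 := mul_le_mul_of_nonneg_left h3 hC
    linarith
  have e1 : b * (lam * (a + b) * (a - 1) + Complex.normSq T1 / (a + b))
      = lam * (a + b) * (b * a - b) + b * Complex.normSq T1 / (a + b) := by ring
  have e2 : a * (lam * (a + b) * (b - 1) + Complex.normSq T2 / (a + b))
      = lam * (a + b) * (b * a - a) + a * Complex.normSq T2 / (b + a) := by
    rw [add_comm b a]; ring
  rw [e1] at p1
  rw [e2] at p2
  linarith

end LocalEstimate

/-! ### `J`-invariant bilinear forms and Hermitian matrices -/

section HermitianForms

/-- The sesquilinear form `h(v, w) = (1/2) (B(v, w) + √-1 B(v, √-1 w))` of a real bilinear form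
`B`. -/
def hermForm (B : C2 →ₗ[ℝ] C2 →ₗ[ℝ] ℝ) (v w : C2) : ℂ :=
  (1 / 2) * ((B v w : ℂ) + Complex.I * (B v (Complex.I • w) : ℂ))

variable {B : C2 →ₗ[ℝ] C2 →ₗ[ℝ] ℝ}

lemma complex_smul_eq (c : ℂ) (v : C2) : c • v = c.re • v + c.im • (Complex.I • v) := by
  conv_lhs => rw [← Complex.re_add_im c]
  rw [add_smul, mul_smul, Complex.coe_smul, Complex.coe_smul]

lemma I_smul_I_smul (v : C2) : Complex.I • (Complex.I • v) = -v := by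
  rw [smul_smul, Complex.I_mul_I, neg_one_smul]

lemma form_I_smul_left (hB : ∀ v w, B (Complex.I • v) (Complex.I • w) = B v w) (v w : C2) :
    B (Complex.I • v) w = -B v (Complex.I • w) := by
  rw [← hB (Complex.I • v) w, I_smul_I_smul, map_neg, LinearMap.neg_apply]

lemma hermForm_add_left (v v' w : C2) :
    hermForm B (v + v') w = hermForm B v w + hermForm B v' w := by
  simp only [hermForm, map_add, LinearMap.add_apply, Complex.ofReal_add]
  ring

lemma hermForm_add_right (v w w' : C2) :
    hermForm B v (w + w') = hermForm B v w + hermForm B v w' := by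
  simp only [hermForm, smul_add, map_add, Complex.ofReal_add]
  ring

/-- Invariance is needed in this slot, through `B (i v) w = -B v (i w)`; conjugate linearity in the
other slot is automatic. -/
lemma hermForm_smul_left (hB : ∀ v w, B (Complex.I • v) (Complex.I • w) = B v w) (c : ℂ)
    (v w : C2) : hermForm B (c • v) w = c * hermForm B v w := by
  rw [complex_smul_eq]
  conv_rhs => rw [← Complex.re_add_im c]
  simp only [hermForm, map_add, map_smul, LinearMap.add_apply, LinearMap.smul_apply, smul_eq_mul,
    form_I_smul_left hB, I_smul_I_smul, map_neg, Complex.ofReal_add, Complex.ofReal_mul,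
    Complex.ofReal_neg]
  linear_combination (-(1 / 2) * (c.im : ℂ) * B v (Complex.I • w)) * Complex.I_sq

lemma hermForm_smul_right (c : ℂ) (v w : C2) : hermForm B v (c • w) = conj c * hermForm B v w := by
  have hc : conj c = c.re - c.im * Complex.I := by
    apply Complex.ext <;> simp
  rw [complex_smul_eq, hc]
  simp only [hermForm, smul_add, smul_comm Complex.I (_ : ℝ), map_add, map_smul, smul_eq_mul,
    I_smul_I_smul, map_neg, Complex.ofReal_add, Complex.ofReal_mul, Complex.ofReal_neg]
  linear_combination ((1 / 2) * (c.im : ℂ) * B v (Complex.I • w)) * Complex.I_sq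

lemma hermForm_eq_sum (hB : ∀ v w, B (Complex.I • v) (Complex.I • w) = B v w) (v w : C2) :
    hermForm B v w = ∑ r, ∑ s, v r * hermForm B (dx r) (dx s) * conj (w s) := by
  conv_lhs => rw [← sum_smul_dx v, ← sum_smul_dx w]
  simp only [Fin.sum_univ_two, hermForm_add_left, hermForm_add_right, hermForm_smul_left hB,
    hermForm_smul_right]
  ring

lemma conj_hermForm (hB : ∀ v w, B (Complex.I • v) (Complex.I • w) = B v w)
    (hsymm : ∀ v w, B v w = B w v) (v w : C2) : conj (hermForm B v w) = hermForm B w v := by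
  have h := form_I_smul_left hB w v
  rw [hsymm] at h
  simp only [hermForm, map_mul, map_add, map_div₀, map_one, map_ofNat, Complex.conj_ofReal,
    Complex.conj_I, h, hsymm v w]
  push_cast
  ring

lemma hermForm_self (hB : ∀ v w, B (Complex.I • v) (Complex.I • w) = B v w)
    (hsymm : ∀ v w, B v w = B w v) (v : C2) : hermForm B v v = ((1 / 2 * B v v : ℝ) : ℂ) := by
  have h := form_I_smul_left hB v v
  rw [hsymm] at h
  have h0 : B v (Complex.I • v) = 0 := by linarith
  simp [hermForm, h0]

/-- The matrix of a positive `J`-invariant form is positive definite. -/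
lemma posDef_hermForm (hB : ∀ v w, B (Complex.I • v) (Complex.I • w) = B v w)
    (hsymm : ∀ v w, B v w = B w v) (hpos : ∀ v, v ≠ 0 → 0 < B v v) :
    (Matrix.of fun i j => hermForm B (dx i) (dx j)).PosDef := by
  refine Matrix.PosDef.of_dotProduct_mulVec_pos ?_ ?_
  · ext i j
    simp only [Matrix.conjTranspose_apply, Matrix.of_apply, RCLike.star_def]
    exact conj_hermForm hB hsymm _ _
  · intro x hx
    -- The conjugate appears because `hermForm` is linear in its first argument, whereas the
    -- quadratic form of a matrix conjugates the left vector.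
    set v : C2 := WithLp.toLp 2 (star x) with hv
    have hv0 : v ≠ 0 := by
      intro h
      apply hx
      ext r
      have := congrArg (fun y : C2 => y r) h
      simpa [hv] using this
    have h1 : star x ⬝ᵥ (Matrix.of fun i j => hermForm B (dx i) (dx j)).mulVec x
        = hermForm B v v := by
      rw [hermForm_eq_sum hB v v]
      simp [dotProduct, Matrix.mulVec, Fin.sum_univ_two, hv]
      ring
    rw [h1, hermForm_self hB hsymm]
    have := hpos v hv0
    exact_mod_cast (by positivity : 0 < 1 / 2 * B v v)

end HermitianForms

/-! ### Holomorphic charts and coordinate vectors -/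

section Charts

variable {M : Type*} [TopologicalSpace M] [ChartedSpace C2 M] {e e' : OpenPartialHomeomorph M C2}
  {z : C2}

lemma mem_contDiffGroupoid_real {t : OpenPartialHomeomorph C2 C2}
    (ht : t ∈ contDiffGroupoid ω 𝓘(ℂ, C2)) : t ∈ contDiffGroupoid ∞ 𝓘(ℝ, C2) := by
  rw [contDiffGroupoid, mem_groupoid_of_pregroupoid] at ht ⊢
  have h1 : ContDiffOn ℂ ω _ _ := ht.1
  have h2 : ContDiffOn ℂ ω _ _ := ht.2
  exact ⟨(h1.of_le le_top).restrict_scalars ℝ, (h2.of_le le_top).restrict_scalars ℝ⟩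

lemma mem_maximalAtlas_real (he : e ∈ IsManifold.maximalAtlas 𝓘(ℂ, C2) ω M) :
    e ∈ IsManifold.maximalAtlas 𝓘(ℝ, C2) ∞ M := by
  rw [IsManifold.mem_maximalAtlas_iff] at he ⊢
  intro e₁ he₁
  exact ⟨mem_contDiffGroupoid_real (he e₁ he₁).1, mem_contDiffGroupoid_real (he e₁ he₁).2⟩

lemma contDiffAt_transition (he : e ∈ IsManifold.maximalAtlas 𝓘(ℂ, C2) ω M)
    (he' : e' ∈ IsManifold.maximalAtlas 𝓘(ℂ, C2) ω M) (hz : z ∈ e'.target)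
    (hz' : e'.symm z ∈ e.source) : ContDiffAt ℂ ω (e ∘ e'.symm) z := by
  have h := IsManifold.compatible_of_mem_maximalAtlas he' he
  rw [contDiffGroupoid, mem_groupoid_of_pregroupoid] at h
  have h1 : ContDiffOn ℂ ω _ _ := h.1
  have hmem : z ∈ (e'.symm.trans e).source := by simp [hz, hz']
  have h2 := h1.contDiffAt (x := z) (by
    refine IsOpen.mem_nhds ?_ ?_
    · simpa using (e'.symm.trans e).open_source
    · simpa using hmem)
  simpa using h2

lemma contMDiffAt_symm (he : e ∈ IsManifold.maximalAtlas 𝓘(ℂ, C2) ω M) (hz : z ∈ e.target) :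
    ContMDiffAt 𝓘(ℝ, C2) 𝓘(ℝ, C2) ∞ e.symm z :=
  contMDiffAt_symm_of_mem_maximalAtlas (mem_maximalAtlas_real he) hz

variable [IsManifold 𝓘(ℂ, C2) ω M]

/-- In the identification of the tangent space with `ℂ²`, coordinate vectors are given by the
derivative of a holomorphic transition map. -/
lemma coordVector_eq (he : e ∈ IsManifold.maximalAtlas 𝓘(ℂ, C2) ω M) (hz : z ∈ e.target)
    (v : C2) :
    coordVector e z v = (fderiv ℂ (chartAt C2 (e.symm z) ∘ e.symm) z v : C2) := by
  have h2 : DifferentiableAt ℂ (chartAt C2 (e.symm z) ∘ e.symm) z :=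
    (contDiffAt_transition (IsManifold.chart_mem_maximalAtlas _) he hz
      (mem_chart_source _ _)).differentiableAt (by simp)
  have h3 : HasMFDerivAt 𝓘(ℝ, C2) 𝓘(ℝ, C2) e.symm z
      ((fderiv ℂ (chartAt C2 (e.symm z) ∘ e.symm) z).restrictScalars ℝ) := by
    refine ⟨(contMDiffAt_symm he hz).continuousAt, ?_⟩
    have h4 := (h2.hasFDerivAt.restrictScalars ℝ).hasFDerivWithinAt (s := Set.univ)
    have h5 : Set.range 𝓘(ℝ, C2) = Set.univ := by simp
    rw [h5]
    exact h4
  rw [coordVector, h3.mfderiv]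
  rfl

end Charts

/-! ### Transformation of the metric, Hessian and Laplacian between charts -/

section Metric

variable {M : Type*} [TopologicalSpace M] [ChartedSpace C2 M]
  {e e' e'' : OpenPartialHomeomorph M C2} {z : C2}

lemma fderiv_transition_comp (he : e ∈ IsManifold.maximalAtlas 𝓘(ℂ, C2) ω M)
    (he' : e' ∈ IsManifold.maximalAtlas 𝓘(ℂ, C2) ω M)
    (he'' : e'' ∈ IsManifold.maximalAtlas 𝓘(ℂ, C2) ω M) (hz : z ∈ e''.target)
    (hz' : e''.symm z ∈ e'.source) (hz'' : e''.symm z ∈ e.source) (v : C2) :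
    fderiv ℂ (e ∘ e''.symm) z v
      = fderiv ℂ (e ∘ e'.symm) (e' (e''.symm z)) (fderiv ℂ (e' ∘ e''.symm) z v) := by
  have h1 : DifferentiableAt ℂ (e' ∘ e''.symm) z :=
    (contDiffAt_transition he' he'' hz hz').differentiableAt (by simp)
  have h2 : DifferentiableAt ℂ (e ∘ e'.symm) ((e' ∘ e''.symm) z) :=
    (contDiffAt_transition he he' (e'.map_source hz')
      (by simpa [e'.left_inv hz'] using hz'')).differentiableAt (by simp)
  have h3 : (e ∘ e''.symm) =ᶠ[𝓝 z] (e ∘ e'.symm) ∘ (e' ∘ e''.symm) := by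
    have : ∀ᶠ w in 𝓝 z, e''.symm w ∈ e'.source :=
      (e''.continuousAt_symm hz).eventually (e'.open_source.mem_nhds hz')
    filter_upwards [this] with w hw
    simp [e'.left_inv hw]
  rw [h3.fderiv_eq, fderiv_comp z h2 h1]
  rfl

lemma fderiv_transition_self {X : Type*} [TopologicalSpace X] {e : OpenPartialHomeomorph X C2}
    (hz : z ∈ e.target) (v : C2) :
    fderiv ℂ (e ∘ e.symm) z v = v := by
  have h : (e ∘ e.symm) =ᶠ[𝓝 z] id := by
    filter_upwards [e.open_target.mem_nhds hz] with w hw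
    simp [e.right_inv hw]
  rw [h.fderiv_eq]
  simp

/-- The complex Hessian transforms as a sesquilinear form. -/
lemma complexHessian_transition {u : M → ℝ} (he : e ∈ IsManifold.maximalAtlas 𝓘(ℂ, C2) ω M)
    (he' : e' ∈ IsManifold.maximalAtlas 𝓘(ℂ, C2) ω M) (hz : z ∈ e'.target)
    (hz' : e'.symm z ∈ e.source) (hu : ContDiffAt ℝ 2 (u ∘ e.symm) (e (e'.symm z))) :
    complexHessian (u ∘ e'.symm) z = (jacobian (e ∘ e'.symm) z).transpose
      * complexHessian (u ∘ e.symm) (e (e'.symm z)) * (jacobian (e ∘ e'.symm) z).map conj := by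
  have hτ : ContDiffAt ℂ 2 (e ∘ e'.symm) z := (contDiffAt_transition he he' hz hz').of_le le_top
  have hev : (fun w => ((u ∘ e'.symm) w : ℂ)) =ᶠ[𝓝 z]
      fun w => (((u ∘ e.symm) ((e ∘ e'.symm) w) : ℝ) : ℂ) := by
    have : ∀ᶠ w in 𝓝 z, e'.symm w ∈ e.source :=
      (e'.continuousAt_symm hz).eventually (e.open_source.mem_nhds hz')
    filter_upwards [this] with w hw
    simp [e.left_inv hw]
  ext i j
  have h := wirtinger_wirtingerBar_comp (i := i) (j := j) hτ hu.ofReal_comp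
  simp only [complexHessian, Matrix.of_apply]
  rw [(hev.wirtingerBar).wirtinger_eq, h]
  simp only [Matrix.mul_apply, Fin.sum_univ_two, Matrix.transpose_apply, Matrix.map_apply,
    Matrix.of_apply, Function.comp_apply]
  ring

variable [IsManifold 𝓘(ℂ, C2) ω M] (g : KahlerMetric M)

/-- The metric in the coordinates `e`, as a real bilinear form on `ℂ²`. -/
def KahlerMetric.form (e : OpenPartialHomeomorph M C2) (z : C2) : C2 →ₗ[ℝ] C2 →ₗ[ℝ] ℝ :=
  LinearMap.mk₂ ℝ (fun v w => g.inner (e.symm z) (coordVector e z v) (coordVector e z w))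
    (fun v v' w => by
      have : coordVector e z (v + v') = coordVector e z v + coordVector e z v' :=
        map_add (mfderiv 𝓘(ℝ, C2) 𝓘(ℝ, C2) e.symm z) v v'
      rw [this, map_add]; rfl)
    (fun c v w => by
      have : coordVector e z (c • v) = c • coordVector e z v :=
        map_smul (mfderiv 𝓘(ℝ, C2) 𝓘(ℝ, C2) e.symm z) c v
      rw [this, map_smul]; rfl)
    (fun v w w' => by
      have : coordVector e z (w + w') = coordVector e z w + coordVector e z w' :=
        map_add (mfderiv 𝓘(ℝ, C2) 𝓘(ℝ, C2) e.symm z) w w'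
      rw [this, map_add])
    (fun c v w => by
      have : coordVector e z (c • w) = c • coordVector e z w :=
        map_smul (mfderiv 𝓘(ℝ, C2) 𝓘(ℝ, C2) e.symm z) c w
      rw [this, map_smul])

lemma KahlerMetric.form_apply (v w : C2) :
    g.form e z v w = g.inner (e.symm z) (coordVector e z v) (coordVector e z w) := rfl

lemma KahlerMetric.form_symm (v w : C2) : g.form e z v w = g.form e z w v :=
  g.symm _ _ _

lemma KahlerMetric.form_I_smul (he : e ∈ IsManifold.maximalAtlas 𝓘(ℂ, C2) ω M)
    (hz : z ∈ e.target) (v w : C2) :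
    g.form e z (Complex.I • v) (Complex.I • w) = g.form e z v w := by
  have h (v : C2) : coordVector e z (Complex.I • v) = tangentJ _ (coordVector e z v) := by
    rw [coordVector_eq he hz, coordVector_eq he hz, map_smul]
    rfl
  rw [form_apply, form_apply, h, h, g.hermitian]

lemma coordVector_ne_zero (he : e ∈ IsManifold.maximalAtlas 𝓘(ℂ, C2) ω M)
    (hz : z ∈ e.target) {v : C2} (hv : v ≠ 0) : coordVector e z v ≠ 0 := by
  intro h
  rw [coordVector_eq he hz] at h
  apply hv
  -- The derivative of the transition to the preferred chart has a left inverse, the derivative of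
  -- the transition back.
  rw [← fderiv_transition_self hz v, fderiv_transition_comp he
    (IsManifold.chart_mem_maximalAtlas (e.symm z)) he hz (mem_chart_source _ _) (e.map_target hz)]
  have h' : fderiv ℂ (chartAt C2 (e.symm z) ∘ e.symm) z v = 0 := h
  rw [h', map_zero]

lemma KahlerMetric.form_pos (he : e ∈ IsManifold.maximalAtlas 𝓘(ℂ, C2) ω M)
    (hz : z ∈ e.target) (v : C2) (hv : v ≠ 0) : 0 < g.form e z v v :=
  g.pos _ _ (coordVector_ne_zero he hz hv)

/-- Serves to identify the fibres over `e.symm (e q)` and `q`, which are equal only propositionally;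
every fibre is a copy of `ℂ²`. -/
lemma inner_congr {p q : M} (h : p = q) (v w : C2) :
    g.inner p (show TangentSpace 𝓘(ℝ, C2) p from v) (show TangentSpace 𝓘(ℝ, C2) p from w)
      = g.inner q (show TangentSpace 𝓘(ℝ, C2) q from v)
          (show TangentSpace 𝓘(ℝ, C2) q from w) := by
  subst h
  rfl

lemma KahlerMetric.form_transition (he : e ∈ IsManifold.maximalAtlas 𝓘(ℂ, C2) ω M)
    (he' : e' ∈ IsManifold.maximalAtlas 𝓘(ℂ, C2) ω M) (hz : z ∈ e'.target)
    (hz' : e'.symm z ∈ e.source) (v w : C2) :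
    g.form e' z v w = g.form e (e (e'.symm z)) (fderiv ℂ (e ∘ e'.symm) z v)
      (fderiv ℂ (e ∘ e'.symm) z w) := by
  have hp : e.symm (e (e'.symm z)) = e'.symm z := e.left_inv hz'
  rw [form_apply, form_apply, coordVector_eq he (e.map_source hz'),
    coordVector_eq he (e.map_source hz'), coordVector_eq he' hz, coordVector_eq he' hz,
    fderiv_transition_comp (IsManifold.chart_mem_maximalAtlas (e'.symm z)) he he' hz hz'
      (mem_chart_source _ _), fderiv_transition_comp (IsManifold.chart_mem_maximalAtlas (e'.symm z))
      he he' hz hz' (mem_chart_source _ _)]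
  refine (inner_congr g hp.symm _ _).trans ?_
  rw [hp]

/-- By `J`-invariance the `dy`-`dy` term repeats the `dx`-`dx` term and the two mixed terms agree up
to sign, which turns the factor `1/4` into `1/2`. -/
lemma KahlerMetric.coordMatrix_eq (he : e ∈ IsManifold.maximalAtlas 𝓘(ℂ, C2) ω M)
    (hz : z ∈ e.target) :
    coordMatrix g.inner e z = Matrix.of fun i j => hermForm (g.form e z) (dx i) (dx j) := by
  have hB := g.form_I_smul he hz
  ext i j
  have h1 := hB (dx i) (dx j)
  have h2 := form_I_smul_left hB (dx i) (dx j)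
  simp only [coordMatrix, Matrix.of_apply, ← form_apply, hermForm, dy_eq]
  rw [h1, h2]
  push_cast
  ring

lemma KahlerMetric.posDef_coordMatrix (he : e ∈ IsManifold.maximalAtlas 𝓘(ℂ, C2) ω M)
    (hz : z ∈ e.target) : (coordMatrix g.inner e z).PosDef := by
  rw [g.coordMatrix_eq he hz]
  exact posDef_hermForm (g.form_I_smul he hz) g.form_symm (g.form_pos he hz)

lemma KahlerMetric.coordMatrix_transition (he : e ∈ IsManifold.maximalAtlas 𝓘(ℂ, C2) ω M)
    (he' : e' ∈ IsManifold.maximalAtlas 𝓘(ℂ, C2) ω M) (hz : z ∈ e'.target)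
    (hz' : e'.symm z ∈ e.source) :
    coordMatrix g.inner e' z = (jacobian (e ∘ e'.symm) z).transpose
      * coordMatrix g.inner e (e (e'.symm z)) * (jacobian (e ∘ e'.symm) z).map conj := by
  rw [g.coordMatrix_eq he' hz, g.coordMatrix_eq he (e.map_source hz')]
  ext i j
  have h : hermForm (g.form e' z) (dx i) (dx j) = hermForm (g.form e (e (e'.symm z)))
      (fderiv ℂ (e ∘ e'.symm) z (dx i)) (fderiv ℂ (e ∘ e'.symm) z (dx j)) := by
    simp only [hermForm, g.form_transition he he' hz hz', map_smul]
  rw [Matrix.of_apply, h, hermForm_eq_sum (g.form_I_smul he (e.map_source hz'))]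
  simp only [Matrix.mul_apply, Fin.sum_univ_two, Matrix.transpose_apply, Matrix.map_apply,
    Matrix.of_apply, jacobian]
  ring

/-- The Jacobian factors cancel by cyclicity of the trace; invertibility of the product forces each
of them to be invertible. -/
lemma trace_inv_mul_congr {G H J : Matrix (Fin 2) (Fin 2) ℂ}
    (h : IsUnit (J.transpose * G * J.map conj).det) :
    Matrix.trace ((J.transpose * G * J.map conj)⁻¹ * (J.transpose * H * J.map conj))
      = Matrix.trace (G⁻¹ * H) := by
  rw [Matrix.det_mul, Matrix.det_mul] at h
  have hJ : IsUnit J.transpose.det := isUnit_of_mul_isUnit_left (isUnit_of_mul_isUnit_left h)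
  have hJ' : IsUnit (J.map conj).det := isUnit_of_mul_isUnit_right h
  rw [Matrix.mul_inv_rev, Matrix.mul_inv_rev, Matrix.trace_mul_comm]
  have e1 : J.transpose * H * J.map conj * ((J.map conj)⁻¹ * (G⁻¹ * J.transpose⁻¹))
      = J.transpose * (H * G⁻¹ * J.transpose⁻¹) := by
    simp only [Matrix.mul_assoc]
    rw [Matrix.mul_nonsing_inv_cancel_left _ _ hJ']
  rw [e1, Matrix.trace_mul_comm, Matrix.mul_assoc, Matrix.nonsing_inv_mul _ hJ, Matrix.mul_one,
    Matrix.trace_mul_comm]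

/-- The Laplacian may be computed in any holomorphic chart. -/
lemma KahlerMetric.laplacian_eq {u : M → ℝ} (he : e ∈ IsManifold.maximalAtlas 𝓘(ℂ, C2) ω M)
    {p : M} (hp : p ∈ e.source) (hu : ContDiffAt ℝ 2 (u ∘ e.symm) (e p)) :
    g.laplacian u p = (Matrix.trace ((coordMatrix g.inner e (e p))⁻¹
      * complexHessian (u ∘ e.symm) (e p))).re := by
  have hc := IsManifold.chart_mem_maximalAtlas (I := 𝓘(ℂ, C2)) (n := ω) p
  have hcp := mem_chart_source C2 p
  have hz := (chartAt C2 p).map_source hcp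
  have hinv := (chartAt C2 p).left_inv hcp
  have h1 := g.coordMatrix_transition he hc hz (by rwa [hinv])
  have h2 := complexHessian_transition (u := u) he hc hz (by rwa [hinv]) (by rwa [hinv])
  have hpd := (g.posDef_coordMatrix hc hz).isUnit
  rw [Matrix.isUnit_iff_isUnit_det] at hpd
  rw [laplacian, matrix, hessianMatrix, h1, h2, trace_inv_mul_congr (by rwa [← h1]), hinv]

end Metric

/-! ### Regularity in coordinates and the Riemannian distance -/

section Smoothness

variable {M : Type*} [TopologicalSpace M] [ChartedSpace C2 M]
  {e : OpenPartialHomeomorph M C2} {z : C2}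

lemma contDiffAt_comp_symm {φ : M → ℝ} {n : ℕ∞} (hφ : ContMDiff 𝓘(ℝ, C2) 𝓘(ℝ, ℝ) n φ)
    (he : e ∈ IsManifold.maximalAtlas 𝓘(ℂ, C2) ω M) (hz : z ∈ e.target) :
    ContDiffAt ℝ n (φ ∘ e.symm) z :=
  (hφ.contMDiffAt.comp z ((contMDiffAt_symm he hz).of_le (by exact_mod_cast le_top))).contDiffAt

variable [IsManifold 𝓘(ℂ, C2) ω M]

/-- The field is the tangent map of `e.symm` applied to a constant section; smoothness of the metric
coefficients is deduced from it. -/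
lemma contMDiffAt_coordVector (he : e ∈ IsManifold.maximalAtlas 𝓘(ℂ, C2) ω M)
    (hz : z ∈ e.target) (v : C2) :
    ContMDiffAt 𝓘(ℝ, C2) (𝓘(ℝ, C2).prod 𝓘(ℝ, C2)) ∞
      (fun w => (⟨e.symm w, coordVector e w v⟩ : TangentBundle 𝓘(ℝ, C2) M)) z := by
  have h1 : ContMDiffOn 𝓘(ℝ, C2) 𝓘(ℝ, C2) ∞ e.symm e.target :=
    contMDiffOn_symm_of_mem_maximalAtlas (mem_maximalAtlas_real he)
  have h2 := h1.contMDiffOn_tangentMapWithin (m := ∞) (by simp) e.open_target.uniqueMDiffOn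
  have h3 : ContMDiffAt 𝓘(ℝ, C2) (𝓘(ℝ, C2).prod 𝓘(ℝ, C2)) ∞
      (fun w => (⟨w, v⟩ : TangentBundle 𝓘(ℝ, C2) C2)) z :=
    contMDiffAt_vectorSpace_iff_contDiffAt.2 contDiffAt_const
  have h4 := (h2.contMDiffAt (x := (⟨z, v⟩ : TangentBundle 𝓘(ℝ, C2) C2))
    ((e.open_target.preimage
      (FiberBundle.continuous_proj C2 (TangentSpace 𝓘(ℝ, C2)))).mem_nhds hz)).comp z h3
  refine h4.congr_of_eventuallyEq ?_
  filter_upwards [e.open_target.mem_nhds hz] with w hw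
  simp only [Function.comp_apply, tangentMapWithin, coordVector,
    mfderivWithin_of_isOpen e.open_target hw]

lemma KahlerMetric.contDiffAt_form (g : KahlerMetric M)
    (he : e ∈ IsManifold.maximalAtlas 𝓘(ℂ, C2) ω M) (hz : z ∈ e.target) (v w : C2) :
    ContDiffAt ℝ ∞ (fun x => g.form e x v w) z := by
  let _ : Bundle.RiemannianBundle (fun p : M => TangentSpace 𝓘(ℝ, C2) p) :=
    ⟨g.toContMDiffRiemannianMetric.toRiemannianMetric⟩
  have h := ContMDiffAt.inner_bundle (contMDiffAt_coordVector he hz v)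
    (contMDiffAt_coordVector he hz w)
  exact h.contDiffAt

lemma KahlerMetric.contDiffAt_coordMatrix (g : KahlerMetric M)
    (he : e ∈ IsManifold.maximalAtlas 𝓘(ℂ, C2) ω M) (hz : z ∈ e.target) (i j : Fin 2) :
    ContDiffAt ℝ ∞ (fun x => coordMatrix g.inner e x i j) z := by
  have h (v w : C2) := (g.contDiffAt_form he hz v w).ofReal_comp
  exact contDiffAt_const.mul (((h (dx i) (dx j)).add (h (dy i) (dy j))).add
    (contDiffAt_const.mul ((h (dx i) (dy j)).sub (h (dy i) (dx j)))))

lemma KahlerMetric.isKahlerAt_coordMatrix (g : KahlerMetric M)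
    (he : e ∈ IsManifold.maximalAtlas 𝓘(ℂ, C2) ω M) (hz : z ∈ e.target) :
    IsKahlerAt (coordMatrix g.inner e) z where
  contDiffAt i j := (g.contDiffAt_coordMatrix he hz i j).of_le (by norm_cast)
  isHermitian := by
    filter_upwards [e.open_target.mem_nhds hz] with w hw
    exact (g.posDef_coordMatrix he hw).isHermitian
  closed := by
    filter_upwards [e.open_target.mem_nhds hz] with w hw i j k
    exact g.closed e he w hw i j k

/-- The Riemannian distance is at most the length of a coordinate segment. -/
lemma KahlerMetric.edist_symm_line_le (g : KahlerMetric M)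
    (he : e ∈ IsManifold.maximalAtlas 𝓘(ℂ, C2) ω M) {v : C2} {a b c : ℝ} (hab : a ≤ b)
    (h : ∀ t ∈ Set.Icc a b, z + t • v ∈ e.target ∧ Real.sqrt (g.form e (z + t • v) v v) ≤ c) :
    g.rdist (e.symm (z + a • v)) (e.symm (z + b • v)) ≤ ENNReal.ofReal (c * (b - a)) := by
  let _ : Bundle.RiemannianBundle (fun p : M => TangentSpace 𝓘(ℝ, C2) p) :=
    ⟨g.toContMDiffRiemannianMetric.toRiemannianMetric⟩
  have hline : ContDiff ℝ ∞ (fun t : ℝ => z + t • v) :=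
    contDiff_const.add (contDiff_id.smul contDiff_const)
  have hγ (t : ℝ) (ht : t ∈ Set.Icc a b) :
      ContMDiffAt 𝓘(ℝ, ℝ) 𝓘(ℝ, C2) ∞ (fun t : ℝ => e.symm (z + t • v)) t :=
    (contMDiffAt_symm he (h t ht).1).comp t hline.contDiffAt.contMDiffAt
  have h1 : g.rdist (e.symm (z + a • v)) (e.symm (z + b • v))
      ≤ Manifold.pathELength 𝓘(ℝ, C2) (fun t : ℝ => e.symm (z + t • v)) a b :=
    Manifold.riemannianEDist_le_pathELength
      (fun t ht => ((hγ t ht).of_le (by norm_cast)).contMDiffWithinAt) rfl rfl hab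
  refine h1.trans ?_
  rw [Manifold.pathELength_eq_lintegral_mfderiv_Icc]
  have h2 (t : ℝ) (ht : t ∈ Set.Icc a b) :
      ‖mfderiv 𝓘(ℝ, ℝ) 𝓘(ℝ, C2) (fun t : ℝ => e.symm (z + t • v)) t 1‖ₑ ≤ ENNReal.ofReal c := by
    have h3 : mfderiv 𝓘(ℝ, ℝ) 𝓘(ℝ, C2) (fun t : ℝ => e.symm (z + t • v)) t 1
        = coordVector e (z + t • v) v := by
      have h4 : HasDerivAt (fun t : ℝ => z + t • v) v t := by
        simpa using ((hasDerivAt_id t).smul_const v).const_add z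
      have h5 := ((contMDiffAt_symm he (h t ht).1).mdifferentiableAt (by simp)).hasMFDerivAt.comp
        t h4.hasFDerivAt.hasMFDerivAt
      have h6 : (fun t : ℝ => e.symm (z + t • v)) = e.symm ∘ fun t : ℝ => z + t • v := rfl
      rw [h6, h5.mfderiv]
      have h7 : ContinuousLinearMap.toSpanSingleton ℝ v (1 : ℝ) = v := by simp
      exact congrArg (mfderiv 𝓘(ℝ, C2) 𝓘(ℝ, C2) e.symm (z + t • v)) h7
    rw [h3, ← ofReal_norm, norm_eq_sqrt_real_inner]
    exact ENNReal.ofReal_le_ofReal (h t ht).2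
  calc _ ≤ ∫⁻ _ in Set.Icc a b, ENNReal.ofReal c :=
        MeasureTheory.setLIntegral_mono' measurableSet_Icc h2
    _ = ENNReal.ofReal (c * (b - a)) := by
      rw [MeasureTheory.setLIntegral_const, Real.volume_Icc, ← ENNReal.ofReal_mul']
      linarith

/-- A function that is Lipschitz for the Riemannian distance has bounded derivative. -/
lemma KahlerMetric.IsLipschitz.abs_fderiv_le {g : KahlerMetric M} {L : ℝ≥0} {h : M → ℝ}
    (hL : g.IsLipschitz L h) (he : e ∈ IsManifold.maximalAtlas 𝓘(ℂ, C2) ω M) (hz : z ∈ e.target)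
    (hd : DifferentiableAt ℝ (h ∘ e.symm) z) (v : C2) :
    |fderiv ℝ (h ∘ e.symm) z v| ≤ L * Real.sqrt (g.form e z v v) := by
  have hline (t : ℝ) : HasDerivAt (fun t : ℝ => z + t • v) v t := by
    simpa using ((hasDerivAt_id t).smul_const v).const_add z
  have h0 : z + (0 : ℝ) • v = z := by simp
  have hcont : Tendsto (fun t : ℝ => z + t • v) (𝓝 0) (𝓝 z) := by
    have := (hline 0).continuousAt.tendsto
    rwa [h0] at this
  refine le_of_forall_pos_le_add fun ε hε => ?_
  -- The speed of a coordinate segment is only close to its value at `z`; `η` is the error allowed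
  -- by continuity, chosen so that `L * η ≤ ε`.
  obtain ⟨η, hη, hηε⟩ : ∃ η > 0, (L : ℝ) * η ≤ ε := by
    refine ⟨ε / (L + 1), by positivity, ?_⟩
    rw [mul_div_assoc', div_le_iff₀ (by positivity)]
    nlinarith [L.coe_nonneg]
  set c : ℝ := Real.sqrt (g.form e z v v) + η with hc
  have hc0 : 0 ≤ c := by positivity
  have hs : ∀ᶠ w in 𝓝 z, w ∈ e.target ∧ Real.sqrt (g.form e w v v) ≤ c := by
    have h1 : ContinuousAt (fun w => Real.sqrt (g.form e w v v)) z :=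
      (g.contDiffAt_form he hz v v).continuousAt.sqrt
    have h2 : ∀ᶠ w in 𝓝 z, Real.sqrt (g.form e w v v) < c :=
      h1.eventually_lt_const (by simp [hc, hη])
    filter_upwards [e.open_target.mem_nhds hz, h2] with w a b using ⟨a, b.le⟩
  obtain ⟨δ, hδ, hball⟩ := Metric.eventually_nhds_iff.1 (hcont.eventually hs)
  -- Stated for arbitrary ordered endpoints so that it serves both `t ≥ 0` and `t ≤ 0` below.
  have hlen (a b : ℝ) (hab : a ≤ b) (ha : -δ < a) (hb : b < δ) :
      |h (e.symm (z + a • v)) - h (e.symm (z + b • v))| ≤ L * c * (b - a) := by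
    have hin (t : ℝ) (ht : t ∈ Set.Icc a b) : z + t • v ∈ e.target
        ∧ Real.sqrt (g.form e (z + t • v) v v) ≤ c := by
      refine hball ?_
      rw [Real.dist_eq, sub_zero, abs_lt]
      exact ⟨ha.trans_le ht.1, ht.2.trans_lt hb⟩
    have hd := g.edist_symm_line_le he hab hin
    have h1 := (hL (e.symm (z + a • v)) (e.symm (z + b • v))).trans (mul_le_mul_right hd L)
    rw [edist_dist, Real.dist_eq, ← ENNReal.ofReal_coe_nnreal,
      ← ENNReal.ofReal_mul L.coe_nonneg, ENNReal.ofReal_le_ofReal_iff] at h1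
    · linarith
    · have : 0 ≤ b - a := sub_nonneg.2 hab
      positivity
  have hder : HasDerivAt (fun t : ℝ => h (e.symm (z + t • v))) (fderiv ℝ (h ∘ e.symm) z v) 0 := by
    have h1 : HasFDerivAt (h ∘ e.symm) (fderiv ℝ (h ∘ e.symm) z) (z + (0 : ℝ) • v) := by
      rw [h0]; exact hd.hasFDerivAt
    exact h1.comp_hasDerivAt (0 : ℝ) (hline 0)
  have hlip : ‖fderiv ℝ (h ∘ e.symm) z v‖ ≤ L * c := by
    refine hder.le_of_lip' (by positivity) ?_
    filter_upwards [Metric.ball_mem_nhds (0 : ℝ) hδ] with t ht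
    rw [Metric.mem_ball, Real.dist_eq, sub_zero, abs_lt] at ht
    rw [Real.norm_eq_abs, Real.norm_eq_abs, sub_zero]
    rcases le_total 0 t with h | h
    · have := hlen 0 t h (by linarith) ht.2
      rw [abs_sub_comm, sub_zero] at this
      rwa [abs_of_nonneg h]
    · have := hlen t 0 h ht.1 hδ
      rwa [zero_sub, ← abs_of_nonpos h] at this
  rw [Real.norm_eq_abs] at hlip
  calc _ ≤ L * c := hlip
    _ = L * Real.sqrt (g.form e z v v) + L * η := by rw [hc]; ring
    _ ≤ _ := by linarith

end Smoothness

/-! ### Linear algebra of 2 × 2 Hermitian matrices -/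

section LinearAlgebra

open scoped MatrixOrder in
/-- Simultaneous diagonalisation of two positive definite Hermitian matrices. -/
lemma exists_simultaneous_diagonalization {G G' : Matrix (Fin 2) (Fin 2) ℂ} (hG : G.PosDef)
    (hG' : G'.PosDef) : ∃ (P : Matrix (Fin 2) (Fin 2) ℂ) (a b : ℝ), 0 < a ∧ 0 < b ∧
      P.transpose * G * P.map conj = 1 ∧
      P.transpose * G' * P.map conj = Matrix.diagonal ![(a : ℂ), (b : ℂ)] := by
  obtain ⟨y, hy, hGy⟩ := CStarAlgebra.isStrictlyPositive_iff_eq_star_mul_self.mp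
    hG.isStrictlyPositive
  rw [Matrix.star_eq_conjTranspose] at hGy
  have hyd : IsUnit y.det := (Matrix.isUnit_iff_isUnit_det y).1 hy
  have hyd' : IsUnit y.conjTranspose.det := by
    rw [Matrix.det_conjTranspose]; exact hyd.star
  have hinj : Function.Injective (y⁻¹).mulVec := by
    apply Matrix.mulVec_injective_of_isUnit
    rw [Matrix.isUnit_iff_isUnit_det]
    exact Matrix.isUnit_nonsing_inv_det y hyd
  have hA := hG'.conjTranspose_mul_mul_same hinj
  set A := (y⁻¹).conjTranspose * G' * y⁻¹ with hAdef
  set U : Matrix (Fin 2) (Fin 2) ℂ := hA.1.eigenvectorUnitary.1 with hU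
  have hUU : U.conjTranspose * U = 1 := by
    rw [← Matrix.star_eq_conjTranspose]
    exact Unitary.coe_star_mul_self hA.1.eigenvectorUnitary
  have hdiag : U.conjTranspose * A * U = Matrix.diagonal ![((hA.1.eigenvalues 0 : ℝ) : ℂ),
      ((hA.1.eigenvalues 1 : ℝ) : ℂ)] := by
    have h := hA.1.conjStarAlgAut_star_eigenvectorUnitary
    rw [Unitary.conjStarAlgAut_star_apply] at h
    rw [← Matrix.star_eq_conjTranspose]
    refine h.trans ?_
    congr 1
    ext i
    fin_cases i <;> rfl
  have hT : ((y⁻¹ * U).map conj).transpose = (y⁻¹ * U).conjTranspose := rfl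
  have hC : ((y⁻¹ * U).map conj).map conj = y⁻¹ * U := by
    ext i j
    simp only [Matrix.map_apply, Complex.conj_conj]
  -- With `G = y* y` and `U` diagonalising `(y⁻¹)* G' y⁻¹`, the matrix `y⁻¹ U` works for the
  -- congruence `Q* G Q`. The convention `Pᵀ G P̄` calls for its conjugate.
  refine ⟨(y⁻¹ * U).map conj, hA.1.eigenvalues 0, hA.1.eigenvalues 1, hA.eigenvalues_pos 0,
    hA.eigenvalues_pos 1, ?_, ?_⟩
  · rw [hT, hC, Matrix.conjTranspose_mul, hGy, Matrix.conjTranspose_nonsing_inv]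
    calc _ = U.conjTranspose * (y.conjTranspose⁻¹ * y.conjTranspose) * (y * y⁻¹) * U := by
          simp only [Matrix.mul_assoc]
      _ = 1 := by
          rw [Matrix.nonsing_inv_mul _ hyd', Matrix.mul_nonsing_inv _ hyd, Matrix.mul_one,
            Matrix.mul_one, hUU]
  · rw [hT, hC, Matrix.conjTranspose_mul, ← hdiag, hAdef]
    simp only [Matrix.mul_assoc]

/-- The entries of a matrix that normalises `G` are bounded in terms of `G`. -/
lemma norm_sq_le_of_normalizing {G P : Matrix (Fin 2) (Fin 2) ℂ}
    (h : P.transpose * G * P.map conj = 1) (q i : Fin 2) :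
    ‖P q i‖ ^ 2 ≤ (‖G 0 0‖ + ‖G 1 1‖) / ‖G.det‖ := by
  have h1 : (P.map conj) * P.transpose * G = 1 := by
    rw [Matrix.mul_assoc]
    exact mul_eq_one_comm.1 h
  have hdet : ((P.map conj) * P.transpose).det * G.det = 1 := by
    rw [← Matrix.det_mul, h1, Matrix.det_one]
  have hdet0 : G.det ≠ 0 := right_ne_zero_of_mul_eq_one hdet
  have h2 : G.det • ((P.map conj) * P.transpose) = G.adjugate := by
    calc _ = (P.map conj) * P.transpose * (G * G.adjugate) := by
          rw [Matrix.mul_adjugate]; simp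
      _ = G.adjugate := by rw [← Matrix.mul_assoc, h1, Matrix.one_mul]
  -- The normalisation means that `P̄ Pᵀ` is the inverse of `G`; its diagonal entries are the
  -- squared norms of the rows of `P`.
  have h3 : G.det * ((‖P q 0‖ ^ 2 + ‖P q 1‖ ^ 2 : ℝ) : ℂ) = G.adjugate q q := by
    rw [← h2]
    simp [Matrix.mul_apply, Fin.sum_univ_two, ← Complex.conj_mul']
  have h4 : ‖G.adjugate q q‖ ≤ ‖G 0 0‖ + ‖G 1 1‖ := by
    fin_cases q <;> simp [Matrix.adjugate_fin_two]
  rw [le_div_iff₀ (norm_pos_iff.2 hdet0)]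
  have h5 : ‖P q i‖ ^ 2 ≤ ‖P q 0‖ ^ 2 + ‖P q 1‖ ^ 2 := by
    fin_cases i
    · simp
    · simp
  have h6 := congrArg norm h3
  rw [norm_mul, Complex.norm_real, Real.norm_of_nonneg (by positivity)] at h6
  nlinarith [norm_nonneg G.det]

lemma mixedDet_add_self (G H : Matrix (Fin 2) (Fin 2) ℂ) :
    mixedDet G (G + H) = 2 * G.det + mixedDet G H := by
  simp only [mixedDet, Matrix.det_fin_two, Matrix.add_apply]
  ring

lemma trace_inv_mul_eq (G : Matrix (Fin 2) (Fin 2) ℂ)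
    (H : Matrix (Fin 2) (Fin 2) ℂ) : Matrix.trace (G⁻¹ * H) = mixedDet G H / G.det := by
  rw [Matrix.inv_def, Ring.inverse_eq_inv', Matrix.adjugate_fin_two, Matrix.smul_mul,
    Matrix.trace_smul, Matrix.trace_fin_two, Matrix.mul_apply, Matrix.mul_apply, smul_eq_mul,
    mixedDet, div_eq_inv_mul]
  simp only [Fin.sum_univ_two, Matrix.of_apply, Matrix.cons_val_zero, Matrix.cons_val_one,
    Matrix.cons_val_fin_one]
  ring

/-- Conjugation swaps the two off-diagonal products and fixes the others, so the quotient is real.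
-/
lemma trace_inv_mul_re {G H : Matrix (Fin 2) (Fin 2) ℂ} (hG : G.PosDef) (hH : H.IsHermitian) :
    (((Matrix.trace (G⁻¹ * H)).re : ℝ) : ℂ) = mixedDet G H / G.det := by
  rw [trace_inv_mul_eq, ← Complex.conj_eq_iff_re]
  have g1 (i j) : conj (G i j) = G j i := hG.1.apply j i
  have h1 (i j) : conj (H i j) = H j i := hH.apply j i
  simp only [mixedDet, Matrix.det_fin_two, map_div₀, map_sub, map_add, map_mul, g1, h1]
  ring

end LinearAlgebra

/-! ### Linear changes of holomorphic coordinates -/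

section LinearChange

variable {M : Type*} [TopologicalSpace M] [ChartedSpace C2 M]

lemma transHomeomorph_mem_maximalAtlas [IsManifold 𝓘(ℂ, C2) ω M]
    {e : OpenPartialHomeomorph M C2} (he : e ∈ IsManifold.maximalAtlas 𝓘(ℂ, C2) ω M)
    (A : C2 ≃L[ℂ] C2) :
    e.transHomeomorph A.symm.toHomeomorph ∈ IsManifold.maximalAtlas 𝓘(ℂ, C2) ω M := by
  apply OpenPartialHomeomorph.mem_maximalAtlas_of_contMDiffOn
  · exact A.symm.contDiff.contMDiff.comp_contMDiffOn (contMDiffOn_of_mem_maximalAtlas he)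
  · exact (contMDiffOn_symm_of_mem_maximalAtlas he).comp A.contDiff.contMDiff.contMDiffOn
      fun x hx => hx

/-- The linear automorphism of `ℂ²` with a given invertible matrix. -/
lemma exists_linearEquiv_of_matrix {P : Matrix (Fin 2) (Fin 2) ℂ} (hP : IsUnit P.det) :
    ∃ A : C2 ≃L[ℂ] C2, ∀ i r, A (dx i) r = P r i := by
  have h (Q R : Matrix (Fin 2) (Fin 2) ℂ) (hQR : Q * R = 1) (x : C2) :
      Matrix.toEuclideanCLM (𝕜 := ℂ) Q (Matrix.toEuclideanCLM (𝕜 := ℂ) R x) = x := by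
    have h1 : Matrix.toEuclideanCLM (𝕜 := ℂ) Q * Matrix.toEuclideanCLM (𝕜 := ℂ) R = 1 := by
      rw [← map_mul, hQR, map_one]
    exact DFunLike.congr_fun h1 x
  refine ⟨ContinuousLinearEquiv.equivOfInverse (Matrix.toEuclideanCLM (𝕜 := ℂ) P)
    (Matrix.toEuclideanCLM (𝕜 := ℂ) P⁻¹) (h _ _ (Matrix.nonsing_inv_mul _ hP))
    (h _ _ (Matrix.mul_nonsing_inv _ hP)), fun i r => ?_⟩
  have : dx i = WithLp.toLp 2 (Pi.single i 1) := rfl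
  simp [this, Matrix.mulVec_single]

end LinearChange

/-! ### Uniform second-derivative bounds and adapted charts -/

section CurvatureBound

lemma wirtinger_wirtingerBar_sum {ι : Type*} (s : Finset ι) {F : ι → C2 → ℂ} {z : C2}
    {i j : Fin 2} (hF : ∀ k ∈ s, ContDiffAt ℝ 2 (F k) z) :
    wirtinger i (wirtingerBar j fun w => ∑ k ∈ s, F k w) z
      = ∑ k ∈ s, wirtinger i (wirtingerBar j (F k)) z := by
  have hev : wirtingerBar j (fun w => ∑ k ∈ s, F k w) =ᶠ[𝓝 z]
      fun w => ∑ k ∈ s, wirtingerBar j (F k) w := by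
    have : ∀ᶠ w in 𝓝 z, ∀ k ∈ s, ContDiffAt ℝ 2 (F k) w :=
      (Filter.eventually_all_finset s).2 fun k hk => (hF k hk).eventually (by simp)
    filter_upwards [this] with w hw
    exact wirtingerBar_sum s fun k hk => (hw k hk).differentiableAt (by norm_num)
  rw [hev.wirtinger_eq, wirtinger_sum s fun k hk =>
    ((hF k hk).wirtingerBar (m := 1) (by norm_num)).differentiableAt (by norm_num)]

lemma wirtinger_wirtingerBar_const_mul {F : C2 → ℂ} {z : C2} {i j : Fin 2} (c : ℂ)
    (hF : ContDiffAt ℝ 2 F z) :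
    wirtinger i (wirtingerBar j fun w => c * F w) z = c * wirtinger i (wirtingerBar j F) z := by
  have hc : wirtingerBar j (fun _ : C2 => c) = fun _ => 0 := by
    ext w; exact wirtingerBar_const _
  rw [wirtinger_wirtingerBar_mul contDiffAt_const hF, wirtinger_const, hc, wirtinger_const]
  ring

/-- The second derivative `∂₂ ∂̄₂ G₁₁̄` of a matrix-valued function in the linear coordinates whose
coordinate vectors are the columns of `P`. -/
def frameSecondDeriv (G : C2 → Matrix (Fin 2) (Fin 2) ℂ) (P : Matrix (Fin 2) (Fin 2) ℂ)
    (z : C2) : ℂ :=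
  ∑ k, ∑ l, P k 1 * (∑ r, ∑ s, P r 0 * conj (P s 0)
    * wirtinger k (wirtingerBar l fun x => G x r s) z) * conj (P l 1)

lemma norm_frameSecondDeriv_le {G : C2 → Matrix (Fin 2) (Fin 2) ℂ}
    {P : Matrix (Fin 2) (Fin 2) ℂ} {z : C2} {κ N : ℝ} (hP : ∀ q i, ‖P q i‖ ^ 2 ≤ κ)
    (hN : ∑ k, ∑ l, ∑ r, ∑ s, ‖wirtinger k (wirtingerBar l fun x => G x r s) z‖ ≤ N) :
    ‖frameSecondDeriv G P z‖ ≤ κ ^ 2 * N := by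
  have hPP (q i q' i') : ‖P q i‖ * ‖P q' i'‖ ≤ κ := by
    nlinarith [hP q i, hP q' i', sq_nonneg (‖P q i‖ - ‖P q' i'‖)]
  have hκ : 0 ≤ κ := (sq_nonneg _).trans (hP 0 0)
  have h1 (k l : Fin 2) : ‖∑ r, ∑ s, P r 0 * conj (P s 0)
      * wirtinger k (wirtingerBar l fun x => G x r s) z‖
      ≤ κ * ∑ r, ∑ s, ‖wirtinger k (wirtingerBar l fun x => G x r s) z‖ := by
    rw [Finset.mul_sum]
    refine norm_sum_le_of_le _ fun r _ => ?_
    rw [Finset.mul_sum]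
    refine norm_sum_le_of_le _ fun s _ => ?_
    rw [norm_mul, norm_mul, Complex.norm_conj]
    exact mul_le_mul_of_nonneg_right (hPP _ _ _ _) (norm_nonneg _)
  have h2 : ‖frameSecondDeriv G P z‖ ≤ κ ^ 2
      * ∑ k, ∑ l, ∑ r, ∑ s, ‖wirtinger k (wirtingerBar l fun x => G x r s) z‖ := by
    rw [frameSecondDeriv, Finset.mul_sum]
    refine norm_sum_le_of_le _ fun k _ => ?_
    rw [Finset.mul_sum]
    refine norm_sum_le_of_le _ fun l _ => ?_
    rw [norm_mul, norm_mul, Complex.norm_conj, mul_right_comm, sq, mul_assoc κ κ]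
    exact mul_le_mul (hPP _ _ _ _) (h1 k l) (norm_nonneg _) hκ
  exact h2.trans (mul_le_mul_of_nonneg_left hN (sq_nonneg κ))

variable {M : Type*} [TopologicalSpace M] [ChartedSpace C2 M] [IsManifold 𝓘(ℂ, C2) ω M]

/-- The second derivatives of the metric near a point are bounded in unitary frames. -/
lemma KahlerMetric.eventually_norm_frameSecondDeriv_le (g : KahlerMetric M)
    {e : OpenPartialHomeomorph M C2} (he : e ∈ IsManifold.maximalAtlas 𝓘(ℂ, C2) ω M) {z : C2}
    (hz : z ∈ e.target) : ∃ C : ℝ, ∀ᶠ w in 𝓝 z, ∀ P : Matrix (Fin 2) (Fin 2) ℂ,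
      P.transpose * coordMatrix g.inner e w * P.map conj = 1 →
      ‖frameSecondDeriv (coordMatrix g.inner e) P w‖ ≤ C := by
  have hG (i j) := g.contDiffAt_coordMatrix he hz i j
  have hGc (i j) : ContinuousAt (fun w => coordMatrix g.inner e w i j) z := (hG i j).continuousAt
  have hN : ContinuousAt (fun w => ∑ k, ∑ l, ∑ r, ∑ s,
      ‖wirtinger k (wirtingerBar l fun x => coordMatrix g.inner e x r s) w‖) z := by
    refine tendsto_finsetSum _ fun k _ => tendsto_finsetSum _ fun l _ =>
      tendsto_finsetSum _ fun r _ => tendsto_finsetSum _ fun s _ => ?_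
    have h : ContDiffAt ℝ 0 (wirtinger k (wirtingerBar l fun x => coordMatrix g.inner e x r s)) z :=
      ((hG r s).wirtingerBar (m := 1) (by norm_cast)).wirtinger (by norm_num)
    exact h.continuousAt.norm
  have hdet : ContinuousAt (fun w => (coordMatrix g.inner e w).det) z := by
    simp only [Matrix.det_fin_two]
    exact ((hGc 0 0).mul (hGc 1 1)).sub ((hGc 0 1).mul (hGc 1 0))
  have hκ : ContinuousAt (fun w => (‖coordMatrix g.inner e w 0 0‖ + ‖coordMatrix g.inner e w 1 1‖)
      / ‖(coordMatrix g.inner e w).det‖) z :=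
    ((hGc 0 0).norm.add (hGc 1 1).norm).div hdet.norm
      (norm_ne_zero_iff.2 (g.posDef_coordMatrix he hz).det_pos.ne')
  -- Strict bounds at `z` persist nearby by continuity. They control the frame `P` as well, because
  -- its entries are bounded in terms of `G`.
  obtain ⟨N, hN'⟩ := exists_gt (∑ k, ∑ l, ∑ r, ∑ s,
      ‖wirtinger k (wirtingerBar l fun x => coordMatrix g.inner e x r s) z‖)
  obtain ⟨κ, hκ'⟩ := exists_gt ((‖coordMatrix g.inner e z 0 0‖ + ‖coordMatrix g.inner e z 1 1‖)
      / ‖(coordMatrix g.inner e z).det‖)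
  refine ⟨κ ^ 2 * N, ?_⟩
  filter_upwards [hN.eventually_lt_const hN', hκ.eventually_lt_const hκ'] with w h1 h2 P hP
  exact norm_frameSecondDeriv_le
    (fun q i => (norm_sq_le_of_normalizing hP q i).trans h2.le) h1.le

/-- Compactness makes the bound uniform on `M`. -/
lemma KahlerMetric.exists_frameSecondDeriv_bound [CompactSpace M] (g : KahlerMetric M) :
    ∃ C : ℝ, 0 ≤ C ∧ ∀ p : M, ∃ e ∈ IsManifold.maximalAtlas 𝓘(ℂ, C2) ω M, p ∈ e.source ∧
      ∀ P : Matrix (Fin 2) (Fin 2) ℂ, P.transpose * coordMatrix g.inner e (e p) * P.map conj = 1 →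
        ‖frameSecondDeriv (coordMatrix g.inner e) P (e p)‖ ≤ C := by
  have key : ∃ C : ℝ, 0 ≤ C ∧ ∀ p ∈ (Set.univ : Set M),
      ∃ e ∈ IsManifold.maximalAtlas 𝓘(ℂ, C2) ω M, p ∈ e.source ∧
      ∀ P : Matrix (Fin 2) (Fin 2) ℂ, P.transpose * coordMatrix g.inner e (e p) * P.map conj = 1 →
        ‖frameSecondDeriv (coordMatrix g.inner e) P (e p)‖ ≤ C := by
    -- The property of admitting a bound passes to subsets and finite unions and holds near each
    -- point, hence on all of the compact `M`. Charts may vary with the point; only the constant is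
    -- shared.
    refine isCompact_univ.induction_on (p := fun S => ∃ C : ℝ, 0 ≤ C ∧ ∀ p ∈ S,
      ∃ e ∈ IsManifold.maximalAtlas 𝓘(ℂ, C2) ω M, p ∈ e.source ∧
      ∀ P : Matrix (Fin 2) (Fin 2) ℂ, P.transpose * coordMatrix g.inner e (e p) * P.map conj = 1 →
        ‖frameSecondDeriv (coordMatrix g.inner e) P (e p)‖ ≤ C) ?_ ?_ ?_ ?_
    · exact ⟨0, le_rfl, fun p hp => absurd hp (Set.notMem_empty p)⟩
    · rintro s t hst ⟨C, hC, h⟩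
      exact ⟨C, hC, fun p hp => h p (hst hp)⟩
    · rintro s t ⟨C, hC, h⟩ ⟨C', hC', h'⟩
      refine ⟨max C C', hC.trans (le_max_left _ _), fun p hp => ?_⟩
      rcases hp with hp | hp
      · obtain ⟨e, he, hpe, hb⟩ := h p hp
        exact ⟨e, he, hpe, fun P hP => (hb P hP).trans (le_max_left _ _)⟩
      · obtain ⟨e, he, hpe, hb⟩ := h' p hp
        exact ⟨e, he, hpe, fun P hP => (hb P hP).trans (le_max_right _ _)⟩
    · intro p _
      have he : chartAt C2 p ∈ IsManifold.maximalAtlas 𝓘(ℂ, C2) ω M :=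
        IsManifold.chart_mem_maximalAtlas p
      have hp := mem_chart_source C2 p
      obtain ⟨C, hC⟩ := g.eventually_norm_frameSecondDeriv_le he ((chartAt C2 p).map_source hp)
      have h1 := ((chartAt C2 p).continuousAt hp).eventually hC
      refine ⟨_, mem_nhdsWithin_of_mem_nhds
        (inter_mem h1 ((chartAt C2 p).open_source.mem_nhds hp)), max C 0, le_max_right _ _, ?_⟩
      rintro q ⟨hq1, hq2⟩
      exact ⟨_, he, hq2, fun P hP => (hq1 P hP).trans (le_max_left _ _)⟩
  obtain ⟨C, hC, h⟩ := key
  exact ⟨C, hC, fun p => h p (Set.mem_univ p)⟩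

/-- Around each point there are holomorphic coordinates in which the metric is the identity and
`g + ∂∂̄φ` is diagonal at the point, with control on the second derivatives of the metric. -/
lemma KahlerMetric.exists_adapted_chart (g : KahlerMetric M) {φ : M → ℝ}
    (hφ : ContMDiff 𝓘(ℝ, C2) 𝓘(ℝ, ℝ) 4 φ) (hadm : g.IsAdmissible φ) {p : M} {C : ℝ}
    (hp : ∃ e ∈ IsManifold.maximalAtlas 𝓘(ℂ, C2) ω M, p ∈ e.source ∧
      ∀ P : Matrix (Fin 2) (Fin 2) ℂ, P.transpose * coordMatrix g.inner e (e p) * P.map conj = 1 →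
        ‖frameSecondDeriv (coordMatrix g.inner e) P (e p)‖ ≤ C) :
    ∃ e ∈ IsManifold.maximalAtlas 𝓘(ℂ, C2) ω M, p ∈ e.source ∧ ∃ a b : ℝ, 0 < a ∧ 0 < b ∧
      coordMatrix g.inner e (e p) = 1 ∧
      coordMatrix g.inner e (e p) + complexHessian (φ ∘ e.symm) (e p)
        = Matrix.diagonal ![(a : ℂ), (b : ℂ)] ∧
      (wirtinger 1 (wirtingerBar 1 fun w => coordMatrix g.inner e w 0 0) (e p)).re ≤ C := by
  obtain ⟨e, he, hpe, hbound⟩ := hp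
  have hz := e.map_source hpe
  obtain ⟨P, a, b, ha, hb, hP1, hP2⟩ := exists_simultaneous_diagonalization
    (g.posDef_coordMatrix he hz) (hadm e he p hpe)
  have hPdet : IsUnit P.det := by
    have h := congrArg Matrix.det hP1
    rw [Matrix.det_mul, Matrix.det_mul, Matrix.det_transpose, Matrix.det_one, mul_assoc] at h
    exact IsUnit.of_mul_eq_one _ h
  obtain ⟨A, hA⟩ := exists_linearEquiv_of_matrix hPdet
  -- The change of chart is linear, so its Jacobian is the constant `P` and second derivatives of
  -- the metric transform without extra terms.
  set e' := e.transHomeomorph A.symm.toHomeomorph with he'def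
  have he' : e' ∈ IsManifold.maximalAtlas 𝓘(ℂ, C2) ω M := transHomeomorph_mem_maximalAtlas he A
  have hpe' : p ∈ e'.source := hpe
  have hz' := e'.map_source hpe'
  have hsymm (w : C2) : e'.symm w = e.symm (A w) := rfl
  have hAw (w : C2) (hw : w ∈ e'.target) : A w ∈ e.target := hw
  have htrans (w : C2) (hw : w ∈ e'.target) : e (e'.symm w) = A w := by
    rw [hsymm, e.right_inv (hAw w hw)]
  have hjac (w : C2) (hw : w ∈ e'.target) : jacobian (e ∘ e'.symm) w = P := by
    have hev : (e ∘ e'.symm) =ᶠ[𝓝 w] A := by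
      filter_upwards [e'.open_target.mem_nhds hw] with x hx using htrans x hx
    ext r i
    rw [jacobian, Matrix.of_apply, hev.fderiv_eq, A.fderiv]
    exact hA i r
  have hGw (w : C2) (hw : w ∈ e'.target) : coordMatrix g.inner e' w
      = P.transpose * coordMatrix g.inner e (A w) * P.map conj := by
    rw [g.coordMatrix_transition he he' hw (e.map_target (hAw w hw)), hjac w hw, htrans w hw]
  have hAz : A (e' p) = e p := by
    rw [← htrans _ hz', e'.left_inv hpe']
  have hG1 := hGw _ hz'
  rw [hAz] at hG1
  have hH1 : complexHessian (φ ∘ e'.symm) (e' p)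
      = P.transpose * complexHessian (φ ∘ e.symm) (e p) * P.map conj := by
    have h := complexHessian_transition (u := φ) he he' hz'
      (by rwa [e'.left_inv hpe']) (by
        rw [e'.left_inv hpe']
        exact (contDiffAt_comp_symm (n := 4) hφ he hz).of_le (by norm_cast))
    rwa [hjac _ hz', e'.left_inv hpe'] at h
  refine ⟨e', he', hpe', a, b, ha, hb, hG1.trans hP1, ?_, ?_⟩
  · rw [hG1, hH1, ← hP2, ← Matrix.add_mul, ← Matrix.mul_add]
    rfl
  · have hGd (r s) : ContDiffAt ℝ 2 (fun x => coordMatrix g.inner e x r s) (A (e' p)) := by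
      rw [hAz]
      exact (g.contDiffAt_coordMatrix he hz r s).of_le (by norm_cast)
    have hev : (fun w => coordMatrix g.inner e' w 0 0) =ᶠ[𝓝 (e' p)] fun w =>
        (fun x => ∑ r, ∑ s, P r 0 * conj (P s 0) * coordMatrix g.inner e x r s) (A w) := by
      filter_upwards [e'.open_target.mem_nhds hz'] with w hw
      rw [hGw w hw]
      simp only [Matrix.mul_apply, Fin.sum_univ_two, Matrix.transpose_apply, Matrix.map_apply]
      ring
    have hsum : ContDiffAt ℝ 2
        (fun x => ∑ r, ∑ s, P r 0 * conj (P s 0) * coordMatrix g.inner e x r s) (A (e' p)) :=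
      ContDiffAt.sum fun r _ => ContDiffAt.sum fun s _ => contDiffAt_const.mul (hGd r s)
    have hjA : jacobian A (e' p) = P := by
      ext r i
      rw [jacobian, Matrix.of_apply, A.fderiv]
      exact hA i r
    have hfr : wirtinger 1 (wirtingerBar 1 fun w => coordMatrix g.inner e' w 0 0) (e' p)
        = frameSecondDeriv (coordMatrix g.inner e) P (e p) := by
      rw [(hev.wirtingerBar).wirtinger_eq,
        wirtinger_wirtingerBar_comp A.contDiff.contDiffAt hsum, hjA, frameSecondDeriv]
      refine Finset.sum_congr rfl fun k _ => Finset.sum_congr rfl fun l _ => ?_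
      congr 2
      rw [wirtinger_wirtingerBar_sum _ fun r _ =>
        ContDiffAt.sum fun s _ => contDiffAt_const.mul (hGd r s)]
      refine Finset.sum_congr rfl fun r _ => ?_
      rw [wirtinger_wirtingerBar_sum _ fun s _ => contDiffAt_const.mul (hGd r s)]
      refine Finset.sum_congr rfl fun s _ => ?_
      rw [wirtinger_wirtingerBar_const_mul _ (hGd r s), hAz]
    rw [hfr]
    exact (Complex.re_le_norm _).trans (hbound P hP1)

end CurvatureBound

/-! ### Regularity of `Δφ` and `f`, and the estimate at a maximum -/

section GlobalEstimate

variable {M : Type*} [TopologicalSpace M] [ChartedSpace C2 M] [IsManifold 𝓘(ℂ, C2) ω M]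
  {g : KahlerMetric M} {f φ : M → ℝ} {e : OpenPartialHomeomorph M C2} {z : C2}

lemma contDiffAt_mixedDet_div {G H : C2 → Matrix (Fin 2) (Fin 2) ℂ}
    (hG : ∀ i j, ContDiffAt ℝ 2 (fun w => G w i j) z)
    (hH : ∀ i j, ContDiffAt ℝ 2 (fun w => H w i j) z) (hdet : (G z).det ≠ 0) :
    ContDiffAt ℝ 2 (fun w => (mixedDet (G w) (H w) / (G w).det).re) z := by
  have hd : ContDiffAt ℝ 2 (fun w => (G w).det) z := by
    simp only [Matrix.det_fin_two]
    exact ((hG 0 0).mul (hG 1 1)).sub ((hG 0 1).mul (hG 1 0))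
  have hm : ContDiffAt ℝ 2 (fun w => mixedDet (G w) (H w)) z := by
    simp only [mixedDet]
    exact ((((hG 1 1).mul (hH 0 0)).add ((hG 0 0).mul (hH 1 1))).sub
      ((hG 0 1).mul (hH 1 0))).sub ((hG 1 0).mul (hH 0 1))
  have h : ContDiffAt ℝ 2 (fun w => mixedDet (G w) (H w) / (G w).det) z := by
    simp only [div_eq_mul_inv]
    exact hm.mul (hd.inv hdet)
  exact Complex.reCLM.contDiff.contDiffAt.comp z h

lemma KahlerMetric.laplacian_symm_eq (hφ : ContMDiff 𝓘(ℝ, C2) 𝓘(ℝ, ℝ) 4 φ)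
    (he : e ∈ IsManifold.maximalAtlas 𝓘(ℂ, C2) ω M) (hz : z ∈ e.target) :
    ((g.laplacian φ (e.symm z) : ℝ) : ℂ)
      = mixedDet (coordMatrix g.inner e z) (complexHessian (φ ∘ e.symm) z)
        / (coordMatrix g.inner e z).det := by
  have hφz : ContDiffAt ℝ 2 (φ ∘ e.symm) z :=
    (contDiffAt_comp_symm (n := 4) hφ he hz).of_le (by norm_cast)
  rw [g.laplacian_eq he (e.map_target hz) (by rwa [e.right_inv hz]), e.right_inv hz]
  exact trace_inv_mul_re (g.posDef_coordMatrix he hz) (isHermitian_complexHessian hφz)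

/-- Two derivatives of `Δφ` enter the maximum principle, which is what requires `φ` to be of class
`C⁴`. -/
lemma KahlerMetric.contDiffAt_laplacian (hφ : ContMDiff 𝓘(ℝ, C2) 𝓘(ℝ, ℝ) 4 φ)
    (he : e ∈ IsManifold.maximalAtlas 𝓘(ℂ, C2) ω M) (hz : z ∈ e.target) :
    ContDiffAt ℝ 2 (fun w => g.laplacian φ (e.symm w)) z := by
  have h := contDiffAt_mixedDet_div (g.isKahlerAt_coordMatrix he hz).contDiffAt
    (isKahlerAt_complexHessian (contDiffAt_comp_symm (n := 4) hφ he hz)).contDiffAt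
    (g.posDef_coordMatrix he hz).det_pos.ne'
  refine h.congr_of_eventuallyEq ?_
  filter_upwards [e.open_target.mem_nhds hz] with w hw
  rw [← g.laplacian_symm_eq hφ he hw, Complex.ofReal_re]

lemma KahlerMetric.continuous_laplacian (hφ : ContMDiff 𝓘(ℝ, C2) 𝓘(ℝ, ℝ) 4 φ) :
    Continuous (g.laplacian φ) := by
  refine continuous_iff_continuousAt.2 fun p => ?_
  have hp := mem_chart_source C2 p
  have h1 : ContinuousAt (fun w => g.laplacian φ ((chartAt C2 p).symm w)) (chartAt C2 p p) :=
    (g.contDiffAt_laplacian hφ (IsManifold.chart_mem_maximalAtlas p)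
      ((chartAt C2 p).map_source hp)).continuousAt
  have h2 := h1.comp ((chartAt C2 p).continuousAt hp)
  refine h2.congr ?_
  filter_upwards [(chartAt C2 p).open_source.mem_nhds hp] with q hq
  simp [(chartAt C2 p).left_inv hq]

lemma KahlerMetric.SolvesMongeAmpere.mul_det_eq (hMA : g.SolvesMongeAmpere f φ)
    (he : e ∈ IsManifold.maximalAtlas 𝓘(ℂ, C2) ω M) (hz : z ∈ e.target) :
    ((f (e.symm z) : ℝ) : ℂ) * (coordMatrix g.inner e z).det
      = (coordMatrix g.inner e z + complexHessian (φ ∘ e.symm) z).det := by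
  have h := hMA e he (e.symm z) (e.map_target hz)
  rw [matrix, hessianMatrix, e.right_inv hz] at h
  exact h.symm

/-- The equation itself gives the regularity: `f` is the quotient of the determinants of `g'` and
`g`. -/
lemma KahlerMetric.SolvesMongeAmpere.contDiffAt (hMA : g.SolvesMongeAmpere f φ)
    (hφ : ContMDiff 𝓘(ℝ, C2) 𝓘(ℝ, ℝ) 4 φ)
    (he : e ∈ IsManifold.maximalAtlas 𝓘(ℂ, C2) ω M) (hz : z ∈ e.target) :
    ContDiffAt ℝ 2 (f ∘ e.symm) z := by
  have hG := g.isKahlerAt_coordMatrix he hz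
  have hG' := hG.add (isKahlerAt_complexHessian (contDiffAt_comp_symm (n := 4) hφ he hz))
  have hdet {G : C2 → Matrix (Fin 2) (Fin 2) ℂ} (hG : IsKahlerAt G z) :
      ContDiffAt ℝ 2 (fun w => (G w).det) z := by
    simp only [Matrix.det_fin_two]
    exact ((hG.contDiffAt 0 0).mul (hG.contDiffAt 1 1)).sub
      ((hG.contDiffAt 0 1).mul (hG.contDiffAt 1 0))
  have h1 := (hdet hG').mul ((hdet hG).inv (g.posDef_coordMatrix he hz).det_pos.ne')
  refine (Complex.reCLM.contDiff.contDiffAt.comp z h1).congr_of_eventuallyEq ?_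
  filter_upwards [e.open_target.mem_nhds hz] with w hw
  have hne := (g.posDef_coordMatrix he hw).det_pos.ne'
  have h2 := hMA.mul_det_eq he hw
  simp only [Function.comp_apply, ← h2, Pi.inv_apply, mul_inv_cancel_right₀ hne,
    Complex.reCLM_apply, Complex.ofReal_re]

/-- The gradient bound `|∂f|² ≤ 8 L² f` in coordinates that are unitary at the point. -/
lemma sum_normSq_wirtinger_le {L : ℝ≥0} (hfpos : ∀ p, 0 < f p)
    (hL : g.IsLipschitz L (fun p => f p ^ (1 / 2 : ℝ)))
    (he : e ∈ IsManifold.maximalAtlas 𝓘(ℂ, C2) ω M) (hz : z ∈ e.target)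
    (hf : DifferentiableAt ℝ (f ∘ e.symm) z) (hG : coordMatrix g.inner e z = 1) :
    ∑ k, Complex.normSq (wirtinger k (fun w => ((f ∘ e.symm) w : ℂ)) z)
      ≤ 8 * (L : ℝ) ^ 2 * (f ∘ e.symm) z := by
  set h : M → ℝ := fun p => f p ^ (1 / 2 : ℝ) with hh
  have hsqrt (p : M) : h p = Real.sqrt (f p) := by rw [hh, Real.sqrt_eq_rpow]
  have hhd : DifferentiableAt ℝ (h ∘ e.symm) z := by
    have : h ∘ e.symm = fun w => Real.sqrt ((f ∘ e.symm) w) := by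
      ext w; exact hsqrt _
    rw [this]
    exact hf.sqrt (hfpos _).ne'
  have hsq : f ∘ e.symm = fun w => (h ∘ e.symm) w * (h ∘ e.symm) w := by
    ext w
    simp only [Function.comp_apply, hsqrt, Real.mul_self_sqrt (hfpos _).le]
  -- Since `g_{k k̄}` is half of `g(∂/∂xᵏ, ∂/∂xᵏ)`, real coordinate vectors have squared length `2`
  -- in unitary coordinates.
  have hform (k : Fin 2) : g.form e z (dx k) (dx k) = 2 := by
    have h1 := congrFun (congrFun (g.coordMatrix_eq he hz) k) k
    rw [hG, Matrix.of_apply, hermForm_self (g.form_I_smul he hz) g.form_symm,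
      Matrix.one_apply_eq] at h1
    have h2 : (1 : ℝ) = 1 / 2 * g.form e z (dx k) (dx k) := by exact_mod_cast h1
    linarith
  have hform' (k : Fin 2) : g.form e z (dy k) (dy k) = 2 := by
    rw [dy_eq, g.form_I_smul he hz, hform]
  -- With `f = h²` the derivative is `2 h ∂ᵥh` and `|∂ᵥh|² ≤ 2L²`, which gives `4 f · 2L²`.
  have hder (v : C2) (hv : g.form e z v v = 2) :
      (fderiv ℝ (f ∘ e.symm) z v) ^ 2 ≤ 8 * (L : ℝ) ^ 2 * (f ∘ e.symm) z := by
    have h1 := hL.abs_fderiv_le he hz hhd v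
    rw [hv] at h1
    have h2 : (fderiv ℝ (h ∘ e.symm) z v) ^ 2 ≤ (L : ℝ) ^ 2 * 2 := by
      have h3 := pow_le_pow_left₀ (abs_nonneg _) h1 2
      rwa [sq_abs, mul_pow, Real.sq_sqrt (by norm_num)] at h3
    have h4 : fderiv ℝ (f ∘ e.symm) z v
        = 2 * (h ∘ e.symm) z * fderiv ℝ (h ∘ e.symm) z v := by
      rw [hsq, fderiv_fun_mul hhd hhd]
      simp only [_root_.add_apply, _root_.smul_apply, smul_eq_mul]
      ring
    have h5 : (f ∘ e.symm) z = (h ∘ e.symm) z ^ 2 := by rw [hsq, sq]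
    rw [h4, h5]
    nlinarith [mul_le_mul_of_nonneg_left h2 (sq_nonneg ((h ∘ e.symm) z))]
  have hk (k : Fin 2) : Complex.normSq (wirtinger k (fun w => ((f ∘ e.symm) w : ℂ)) z)
      ≤ 4 * (L : ℝ) ^ 2 * (f ∘ e.symm) z := by
    rw [wirtinger, fderiv_ofReal_apply hf, fderiv_ofReal_apply hf]
    have h1 := hder (dx k) (hform k)
    have h2 := hder (dy k) (hform' k)
    simp [Complex.normSq_apply] at h1 h2 ⊢
    nlinarith
  rw [Fin.sum_univ_two]
  linarith [hk 0, hk 1]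

/-- Clearing the denominator makes the right side polynomial in the matrix entries, the form in
which it is differentiated. -/
lemma KahlerMetric.two_add_laplacian_mul_det (g : KahlerMetric M)
    (hφ : ContMDiff 𝓘(ℝ, C2) 𝓘(ℝ, ℝ) 4 φ)
    (he : e ∈ IsManifold.maximalAtlas 𝓘(ℂ, C2) ω M) (hz : z ∈ e.target) :
    ((2 + g.laplacian φ (e.symm z) : ℝ) : ℂ) * (coordMatrix g.inner e z).det
      = mixedDet (coordMatrix g.inner e z)
        (coordMatrix g.inner e z + complexHessian (φ ∘ e.symm) z) := by
  have hne := (g.posDef_coordMatrix he hz).det_pos.ne'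
  rw [Complex.ofReal_add, g.laplacian_symm_eq hφ he hz, mixedDet_add_self, add_mul,
    div_mul_cancel₀ _ hne, Complex.ofReal_ofNat]

lemma two_add_laplacian_eq (hφ : ContMDiff 𝓘(ℝ, C2) 𝓘(ℝ, ℝ) 4 φ)
    (he : e ∈ IsManifold.maximalAtlas 𝓘(ℂ, C2) ω M) {p : M} (hp : p ∈ e.source) {a b : ℝ}
    (hG : coordMatrix g.inner e (e p) = 1)
    (hG' : coordMatrix g.inner e (e p) + complexHessian (φ ∘ e.symm) (e p)
      = Matrix.diagonal ![(a : ℂ), (b : ℂ)]) : 2 + g.laplacian φ p = a + b := by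
  have h := g.two_add_laplacian_mul_det hφ he (e.map_source hp)
  rw [hG', hG, e.left_inv hp] at h
  simp [mixedDet] at h
  apply Complex.ofReal_injective
  push_cast
  exact h

/-- At an interior maximum of `(2 + Δφ) exp (-lam φ)` the trace satisfies a quadratic inequality. -/
lemma sq_trace_le_of_isMax {L : ℝ≥0} {A C lam : ℝ} {p : M} (hfpos : ∀ p, 0 < f p)
    (hA : -A ≤ g.laplacian f p) (hL : g.IsLipschitz L (fun p => f p ^ (1 / 2 : ℝ)))
    (hφ : ContMDiff 𝓘(ℝ, C2) 𝓘(ℝ, ℝ) 4 φ) (hMA : g.SolvesMongeAmpere f φ)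
    (hadm : g.IsAdmissible φ) (hC : 0 ≤ C)
    (hp : ∃ e ∈ IsManifold.maximalAtlas 𝓘(ℂ, C2) ω M, p ∈ e.source ∧
      ∀ P : Matrix (Fin 2) (Fin 2) ℂ, P.transpose * coordMatrix g.inner e (e p) * P.map conj = 1 →
        ‖frameSecondDeriv (coordMatrix g.inner e) P (e p)‖ ≤ C)
    (hmax : ∀ q, (2 + g.laplacian φ q) * Real.exp (-lam * φ q)
      ≤ (2 + g.laplacian φ p) * Real.exp (-lam * φ p)) :
    (lam - C) * (2 + g.laplacian φ p) ^ 2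
      ≤ A + 8 * (L : ℝ) ^ 2 + 2 * lam * f p * (2 + g.laplacian φ p) := by
  obtain ⟨e, he, hpe, a, b, ha, hb, hG1, hG'1, hcurv⟩ := g.exists_adapted_chart hφ hadm hp
  have hz := e.map_source hpe
  have hinv := e.left_inv hpe
  have hG := g.isKahlerAt_coordMatrix he hz
  have hφ4 : ContDiffAt ℝ 4 (φ ∘ e.symm) (e p) := contDiffAt_comp_symm (n := 4) hφ he hz
  have hG' := hG.add (isKahlerAt_complexHessian hφ4)
  have hfd := hMA.contDiffAt hφ he hz
  have hTd : ContDiffAt ℝ 2 (fun w => 2 + g.laplacian φ (e.symm w)) (e p) :=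
    contDiffAt_const.add (g.contDiffAt_laplacian hφ he hz)
  have hnear := e.open_target.mem_nhds hz
  have hf : ∀ᶠ w in 𝓝 (e p), (((f ∘ e.symm) w : ℝ) : ℂ) * (coordMatrix g.inner e w).det
      = (coordMatrix g.inner e w + complexHessian (φ ∘ e.symm) w).det := by
    filter_upwards [hnear] with w hw using hMA.mul_det_eq he hw
  have hTab := two_add_laplacian_eq hφ he hpe hG1 hG'1
  have hfab : f p = a * b := by
    have h := hMA.mul_det_eq he hz
    rw [hG'1, hG1, hinv] at h
    simp at h
    exact_mod_cast h
  have hlap : -A ≤ (∑ k, wirtinger k (wirtingerBar k fun w => ((f ∘ e.symm) w : ℂ)) (e p)).re := by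
    rw [g.laplacian_eq he hpe hfd, hG1, inv_one, Matrix.one_mul] at hA
    exact hA
  have hgrad := sum_normSq_wirtinger_le hfpos hL he hz (hfd.differentiableAt (by norm_num)) hG1
  have hφk (k : Fin 2) : wirtinger k (wirtingerBar k fun w => ((φ ∘ e.symm) w : ℂ)) (e p)
      = (coordMatrix g.inner e (e p) + complexHessian (φ ∘ e.symm) (e p)) k k
        - coordMatrix g.inner e (e p) k k := by
    rw [Matrix.add_apply, add_sub_cancel_left]
    rfl
  have hloc : IsLocalMax (fun w => (2 + g.laplacian φ (e.symm w))
      * Real.exp (-lam * (φ ∘ e.symm) w)) (e p) := by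
    refine Eventually.of_forall fun w => ?_
    have h := hmax (e.symm w)
    simpa only [Function.comp_apply, hinv] using h
  have key := quadratic_estimate_of_isLocalMax hG hG' hfd hTd (hφ4.of_le (by norm_num)) hf
    (by filter_upwards [hnear] with w hw using g.two_add_laplacian_mul_det hφ he hw)
    hG1 hG'1 ha hb hφk hloc hlap hgrad hcurv hC
  rw [hTab, hfab]
  linarith

end GlobalEstimate

end KahlerSurface

end

/-! ### The global Laplacian bound -/

open KahlerSurface
theorem mainTheorem5 (M : Type*) [TopologicalSpace M] [T2Space M] [CompactSpace M]
    [ChartedSpace C2 M] [IsManifold 𝓘(ℂ, C2) ω M] (g : KahlerMetric M)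
    (oscBound A supBound : ℝ) (L : ℝ≥0) :
    ∃ C : ℝ, ∀ f φ : M → ℝ,
      (∀ p, 0 < f p) →
      (∀ p, f p ≤ supBound) →
      (∀ p, -A ≤ g.laplacian f p) →
      g.IsLipschitz L (fun p => f p ^ (1 / 2 : ℝ)) →
      ContMDiff 𝓘(ℝ, C2) 𝓘(ℝ, ℝ) 4 φ →
      g.SolvesMongeAmpere f φ →
      g.IsAdmissible φ →
      (∀ p q, φ p - φ q ≤ oscBound) →
      ∀ p, |g.laplacian φ p| ≤ C := by
  obtain ⟨K, hK, hcurv⟩ := g.exists_frameSecondDeriv_bound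
  -- This choice makes the coefficient `lam - K` of `T²` equal to `1`.
  set lam : ℝ := K + 1 with hlam
  set α : ℝ := |A| + 8 * (L : ℝ) ^ 2 with hα
  set β : ℝ := 2 * lam * |supBound| with hβ
  have hlam0 : 0 < lam := by positivity
  -- The first term bounds `2 + Δφ` from above; the summand `2` covers the lower bound `Δφ > -2`.
  refine ⟨(α + β + 1) * Real.exp (lam * oscBound) + 2, ?_⟩
  intro f φ hfpos hfS hlap hL hφ hMA hadm hosc q
  have hpos (r : M) : 0 < 2 + g.laplacian φ r := by
    obtain ⟨e, he, hre, a, b, ha, hb, hG, hG', -⟩ := g.exists_adapted_chart hφ hadm (hcurv r)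
    rw [two_add_laplacian_eq hφ he hre hG hG']
    positivity
  have hcont : Continuous fun p => (2 + g.laplacian φ p) * Real.exp (-lam * φ p) :=
    (continuous_const.add (g.continuous_laplacian hφ)).mul
      (Real.continuous_exp.comp (continuous_const.mul hφ.continuous))
  obtain ⟨p, -, hp⟩ := isCompact_univ.exists_isMaxOn ⟨q, Set.mem_univ q⟩ hcont.continuousOn
  have hmax (r : M) := hp (Set.mem_univ r)
  have hquad := sq_trace_le_of_isMax hfpos (hlap p) hL hφ hMA hadm hK (hcurv p) hmax
  have hTp := hpos p
  have hTq := hpos q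
  have hα0 : 0 ≤ α := by positivity
  have hβ0 : 0 ≤ β := by positivity
  have hbound : 2 + g.laplacian φ p ≤ α + β + 1 := by
    generalize 2 + g.laplacian φ p = T at *
    have h1 : 2 * lam * f p * T ≤ β * T := by
      have h2 : f p ≤ |supBound| := (hfS p).trans (le_abs_self _)
      rw [hβ]
      gcongr
    have h3 : (lam - K) * T ^ 2 = T ^ 2 := by rw [hlam]; ring
    have h4 : T ^ 2 ≤ α + β * T := by linarith [le_abs_self A]
    -- If `T > α + β + 1 ≥ 1`, then `T² > (α + β + 1) T > α + β T`, a contradiction.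
    by_contra! hlt
    nlinarith
  -- Comparing the test function at `q` with its maximum at `p` costs only an exponential of the
  -- oscillation of `φ`.
  have hexp : 2 + g.laplacian φ q
      ≤ (2 + g.laplacian φ p) * Real.exp (lam * (φ q - φ p)) := by
    have h1 := mul_le_mul_of_nonneg_right (hmax q) (Real.exp_pos (lam * φ q)).le
    simp only [mul_assoc, ← Real.exp_add] at h1
    have e1 : -lam * φ q + lam * φ q = 0 := by ring
    have e2 : -lam * φ p + lam * φ q = lam * (φ q - φ p) := by ring
    rwa [e1, e2, Real.exp_zero, mul_one] at h1
  have hfin : 2 + g.laplacian φ q ≤ (α + β + 1) * Real.exp (lam * oscBound) := by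
    refine hexp.trans ?_
    have := hosc q p
    gcongr
  rw [abs_le]
  constructor <;> linarith
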